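/- Let $n>2$ and let $\Omega\subset\mathbb R^n$ be a bounded open set with Lebesgue measure $|\Omega|$. Let $a:\Omega\times\mathbb R\to\mathbb R$ be a Carathéodory function (measurable in $x$ for every $s$, continuous in $s$ for almost every $x$) such that, for some constants $\alpha,\beta>0$ and $\theta\ge 0$, $$\frac{\alpha}{(1+|s|)^\theta\ln^\theta(e+|s|)}\le a(x,s)\le\beta\qquad\text{for a.e. }x\in\Omega\text{ and every }s\in\mathbb R .$$ For $m>0$ let $L_w^m(\Omega)$ be the Marcinkiewicz space of all measurable $f$ on $\Omega$ for which there is a constant $\gamma$ with $|\{x\in\Omega:|f(x)|>t\}|\le\gamma t^{-m}$ for all $t>0$, and let $\|f\|_{L_w^m(\Omega)}^m$ be the infimum of all such $\gamma>0$. Let $f\in L_w^m(\Omega)$ with $m>(2^*)'=\frac{2n}{n+2}$, and let $u\in W_0^{1,2}(\Omega)$ be a weak solution of $-\mathrm{div}(a(x,u)Du)=f$ in $\Omega$, $u=0$ on $\partial\Omega$, that is, $$\int_\Omega a(x,u)\,Du\cdot Dv\,dx=\int_\Omega f v\,dx\qquad\text{for all }v\in W_0^{1,2}(\Omega).$$ Let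 $\mu\ge 1$ be any constant such that the function $g(t)=t\ln(e+t)$ satisfies $g(\lambda t)\le\lambda^\mu g(t)$ for all $\lambda>1$ and $t>0$ (for example $\mu=2$). Then: (i) If $m>\frac n2$ and $0\le\theta<1$, there is a constant $L>0$, depending only on $n,\alpha,\beta,\mu,\|f\|_{L_w^m(\Omega)},m$ and $|\Omega|$, such that $|u|\le 2L$ a.e. in $\Omega$. (ii) If $m=\frac n2$ and $0\le\mu\theta<1$, there is a constant $\lambda>0$, depending only on $n,\alpha,\|f\|_{L_w^m(\Omega)},m,\theta$ and $\mu$, such that $e^{\lambda|u|^\rho}\in L^1(\Omega)$ for every $\rho$ with $0<\rho<1-\theta$. (iii) If $(2^*)'<m<\frac n2$ and $0\le\theta<1$, then $|u|\ln(e+|u|)\in L_w^{\varrho}(\Omega)$ for every $\varrho$ with $0<\varrho<\frac{nm}{n-2m}(1-\theta)=m^{**}(1-\theta)$. -/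

import Mathlib

open MeasureTheory Filter Topology

noncomputable section

namespace DegenerateElliptic

/-- The test functions `C_c^∞(Ω)`: smooth functions with compact support contained in `Ω`. -/
def IsTestFunction {n : ℕ} (Ω : Set (EuclideanSpace ℝ (Fin n)))
    (φ : EuclideanSpace ℝ (Fin n) → ℝ) : Prop :=
  ContDiff ℝ (⊤ : ℕ∞) φ ∧ HasCompactSupport φ ∧ tsupport φ ⊆ Ω

/-- `u ∈ W^{1,2}(Ω)` and `Du` is its weak gradient: `u` and `Du` are square integrable on `Ω`, and
`∫_Ω u ∇φ = - ∫_Ω φ Du` for all test functions `φ`. -/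
structure HasW12Gradient {n : ℕ} (Ω : Set (EuclideanSpace ℝ (Fin n)))
    (u : EuclideanSpace ℝ (Fin n) → ℝ)
    (Du : EuclideanSpace ℝ (Fin n) → EuclideanSpace ℝ (Fin n)) : Prop where
  memLp : MemLp u 2 (volume.restrict Ω)
  memLp_grad : MemLp Du 2 (volume.restrict Ω)
  integral_eq : ∀ φ : EuclideanSpace ℝ (Fin n) → ℝ, IsTestFunction Ω φ →
    ∫ x in Ω, u x • gradient φ x = - ∫ x in Ω, φ x • Du x

/-- `u ∈ W_0^{1,2}(Ω)` with weak gradient `Du`: `u ∈ W^{1,2}(Ω)` is the limit, in the norm of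
`W^{1,2}(Ω)`, of a sequence of test functions. -/
structure HasW012Gradient {n : ℕ} (Ω : Set (EuclideanSpace ℝ (Fin n)))
    (u : EuclideanSpace ℝ (Fin n) → ℝ)
    (Du : EuclideanSpace ℝ (Fin n) → EuclideanSpace ℝ (Fin n)) : Prop where
  hasW12Gradient : HasW12Gradient Ω u Du
  exists_approx : ∃ φ : ℕ → EuclideanSpace ℝ (Fin n) → ℝ,
    (∀ k, IsTestFunction Ω (φ k)) ∧
    Tendsto (fun k => eLpNorm (fun x => φ k x - u x) 2 (volume.restrict Ω)) atTop (𝓝 0) ∧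
    Tendsto (fun k => eLpNorm (fun x => gradient (φ k) x - Du x) 2 (volume.restrict Ω))
      atTop (𝓝 0)

/-- `a : Ω × ℝ → ℝ` is a Carathéodory function. Lebesgue measurability on `Ω` is a.e.-measurability
for the restricted Lebesgue measure. -/
structure IsCaratheodory {n : ℕ} (Ω : Set (EuclideanSpace ℝ (Fin n)))
    (a : EuclideanSpace ℝ (Fin n) → ℝ → ℝ) : Prop where
  aemeasurable : ∀ s : ℝ, AEMeasurable (fun x => a x s) (volume.restrict Ω)
  continuous : ∀ᵐ x ∂(volume.restrict Ω), Continuous (a x)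

/-- `α / ((1 + |s|)^θ ln^θ(e + |s|)) ≤ a(x, s) ≤ β` for a.e. `x ∈ Ω` and all `s`. -/
def DegenerateBounds {n : ℕ} (Ω : Set (EuclideanSpace ℝ (Fin n))) (α β θ : ℝ)
    (a : EuclideanSpace ℝ (Fin n) → ℝ → ℝ) : Prop :=
  ∀ᵐ x ∂(volume.restrict Ω), ∀ s : ℝ,
    α / ((1 + |s|) ^ θ * Real.log (Real.exp 1 + |s|) ^ θ) ≤ a x s ∧ a x s ≤ β

/-- `|{x ∈ Ω : |f(x)| > t}| ≤ γ / t^m` for all `t > 0`. -/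
def WeakBound {n : ℕ} (m : ℝ) (Ω : Set (EuclideanSpace ℝ (Fin n)))
    (f : EuclideanSpace ℝ (Fin n) → ℝ) (γ : ℝ) : Prop :=
  ∀ t : ℝ, 0 < t → volume {x | x ∈ Ω ∧ t < |f x|} ≤ ENNReal.ofReal (γ / t ^ m)

/-- The Marcinkiewicz space `L_w^m(Ω)`. -/
def MemWeakL {n : ℕ} (m : ℝ) (Ω : Set (EuclideanSpace ℝ (Fin n)))
    (f : EuclideanSpace ℝ (Fin n) → ℝ) : Prop :=
  AEMeasurable f (volume.restrict Ω) ∧ ∃ γ : ℝ, WeakBound m Ω f γ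

/-- `‖f‖_{L_w^m(Ω)}`, whose `m`-th power is the infimum of the constants `γ > 0` in the defining
inequality of `L_w^m(Ω)`; meaningful for `f ∈ L_w^m(Ω)`. -/
def weakNorm {n : ℕ} (m : ℝ) (Ω : Set (EuclideanSpace ℝ (Fin n)))
    (f : EuclideanSpace ℝ (Fin n) → ℝ) : ℝ :=
  (sInf {γ : ℝ | 0 < γ ∧ WeakBound m Ω f γ}) ^ (1 / m)

/-- `u ∈ W_0^{1,2}(Ω)` is a weak solution of `-div(a(x, u) Du) = f` in `Ω`, `u = 0` on `∂Ω`.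
(The weak gradients `Du`, `Dv` are determined almost everywhere in `Ω`.) -/
def IsWeakSolution {n : ℕ} (Ω : Set (EuclideanSpace ℝ (Fin n)))
    (a : EuclideanSpace ℝ (Fin n) → ℝ → ℝ) (f u : EuclideanSpace ℝ (Fin n) → ℝ) : Prop :=
  ∃ Du : EuclideanSpace ℝ (Fin n) → EuclideanSpace ℝ (Fin n),
    HasW012Gradient Ω u Du ∧
    ∀ (v : EuclideanSpace ℝ (Fin n) → ℝ)
      (Dv : EuclideanSpace ℝ (Fin n) → EuclideanSpace ℝ (Fin n)),
      HasW012Gradient Ω v Dv →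
      ∫ x in Ω, a x (u x) * inner ℝ (Du x) (Dv x) = ∫ x in Ω, f x * v x

/-- The function `g(t) = t ln(e + t)`. -/
def gLog (t : ℝ) : ℝ := t * Real.log (Real.exp 1 + t)

/-- `μ ≥ 1` and `g(λ t) ≤ λ^μ g(t)` for all `λ > 1` and `t > 0`, where `g(t) = t ln(e + t)`. -/
def IsGrowthExponent (μ : ℝ) : Prop :=
  1 ≤ μ ∧ ∀ l : ℝ, 1 < l → ∀ t : ℝ, 0 < t → gLog (l * t) ≤ l ^ μ * gLog t

end DegenerateElliptic

end

/-!
Let `G` be a smooth increasing function with `G 0 = 0` and `G' ≤ K / ((1 + |s|)^θ ln^θ(e + |s|))`,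
and let `Ψ` be a smooth odd cutoff of `G` rising from `0` to `1` between the levels `k` and `k + δ`.
Testing with `Ψ(u)`, the slope of `G` pays for the degeneracy of the coefficient, whence
`‖D Ψ(u)‖₂² ≤ C δ⁻¹ ∫ |f| |Ψ(u)|`. The Sobolev inequality on the left and the Marcinkiewicz bound
`∫_A |f| ≤ C |A|^{1 - 1/m}` on the right give Stampacchia's decay of `φ(t) = |{|G(u)| > t}|`,
`φ(k + δ) ≤ C δ^{-n/(n-2)} φ(k)^b` with `b = (1 - 1/m) n/(n - 2)`.

If `m > n/2` then `b > 1` and `φ` vanishes beyond a finite level; with `G = arsinh ∘ arsinh`, which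
is admissible with `K = 4` for all `θ ≤ 1`, this level depends on neither `θ` nor `β`. If `m = n/2`
then `b = 1` and `φ` decays exponentially; if `m < n/2` then `b < 1` and `φ(t) = O(t^{-m**})`. In
these two cases `G(s) = s (1 + s²)^{-τ/2}`, of growth `|s|^{1 - τ}`, is admissible for every
`τ > θ`, and the strict inequalities for the exponents `ρ` and `ϱ` leave room both for `τ > θ` and
for the logarithm. The same room makes every `λ` admissible in (ii).
-/

namespace DegenerateElliptic

section Gradient

variable {E : Type*} [NormedAddCommGroup E] [InnerProductSpace ℝ E] [CompleteSpace E]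

theorem norm_gradient (f : E → ℝ) (x : E) : ‖gradient f x‖ = ‖fderiv ℝ f x‖ :=
  LinearIsometryEquiv.norm_map _ _

theorem gradient_comp {Ψ : ℝ → ℝ} {f : E → ℝ} {x : E} (hΨ : DifferentiableAt ℝ Ψ (f x))
    (hf : DifferentiableAt ℝ f x) :
    gradient (fun y => Ψ (f y)) x = deriv Ψ (f x) • gradient f x := by
  have h : fderiv ℝ (fun y => Ψ (f y)) x = deriv Ψ (f x) • fderiv ℝ f x :=
    (hΨ.hasDerivAt.comp_hasFDerivAt x hf.hasFDerivAt).fderiv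
  simp only [gradient, h, map_smulₛₗ, conj_trivial]

theorem support_gradient_subset (f : E → ℝ) : Function.support (gradient f) ⊆ tsupport f :=
  fun x hx => support_fderiv_subset ℝ <| by
    rwa [Function.mem_support, ← norm_ne_zero_iff, norm_gradient, norm_ne_zero_iff] at hx

theorem integral_smul_gradient_eq_neg [FiniteDimensional ℝ E] [MeasurableSpace E] [BorelSpace E]
    {ν : Measure E} [ν.IsAddHaarMeasure] {f g : E → ℝ} (hf : Differentiable ℝ f)
    (hg : Differentiable ℝ g) (hfg : Integrable (fun x => f x * g x) ν)
    (hfg' : Integrable (fun x => f x • gradient g x) ν)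
    (hgf' : Integrable (fun x => g x • gradient f x) ν) :
    ∫ x, f x • gradient g x ∂ν = - ∫ x, g x • gradient f x ∂ν := by
  refine ext_inner_left ℝ fun v => ?_
  have hfg'_inner := hfg'.const_inner (𝕜 := ℝ) v
  have hgf'_inner := hgf'.const_inner (𝕜 := ℝ) v
  rw [inner_neg_right, ← integral_inner hfg', ← integral_inner hgf']
  simp only [inner_smul_right, inner_gradient_right, conj_trivial] at hfg'_inner hgf'_inner ⊢
  rw [integral_mul_fderiv_eq_neg_fderiv_mul_of_integrable
    (by simpa only [mul_comm] using hgf'_inner) hfg'_inner hfg (fun x _ => hf x) fun x _ => hg x]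
  simp only [mul_comm]

end Gradient

namespace IsTestFunction

variable {n : ℕ} {Ω : Set (EuclideanSpace ℝ (Fin n))} {φ ψ : EuclideanSpace ℝ (Fin n) → ℝ}

theorem differentiable (hφ : IsTestFunction Ω φ) : Differentiable ℝ φ :=
  hφ.1.differentiable (by simp)

theorem continuous_gradient (hφ : IsTestFunction Ω φ) : Continuous (gradient φ) :=
  (InnerProductSpace.toDual ℝ _).symm.continuous.comp (hφ.1.continuous_fderiv (by simp))

theorem hasCompactSupport_gradient (hφ : IsTestFunction Ω φ) : HasCompactSupport (gradient φ) :=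
  hφ.2.1.mono' (support_gradient_subset φ)

theorem memLp (hφ : IsTestFunction Ω φ) (p : ENNReal) : MemLp φ p (volume.restrict Ω) :=
  (hφ.1.continuous.memLp_of_hasCompactSupport hφ.2.1).restrict Ω

theorem memLp_gradient (hφ : IsTestFunction Ω φ) (p : ENNReal) :
    MemLp (gradient φ) p (volume.restrict Ω) :=
  (hφ.continuous_gradient.memLp_of_hasCompactSupport hφ.hasCompactSupport_gradient).restrict Ω

theorem comp (hφ : IsTestFunction Ω φ) {Ψ : ℝ → ℝ} (hΨ : ContDiff ℝ (⊤ : ℕ∞) Ψ) (h0 : Ψ 0 = 0) :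
    IsTestFunction Ω (fun x => Ψ (φ x)) :=
  ⟨hΨ.comp hφ.1, hφ.2.1.comp_left h0,
    (closure_mono (Function.support_comp_subset h0 φ)).trans hφ.2.2⟩

theorem integrable_smul_gradient (hψ : IsTestFunction Ω ψ) (hφ : IsTestFunction Ω φ) :
    Integrable (fun x => ψ x • gradient φ x) :=
  (hψ.1.continuous.smul hφ.continuous_gradient).integrable_of_hasCompactSupport
    hψ.2.1.smul_right

theorem setIntegral_smul_gradient (hψ : IsTestFunction Ω ψ) :
    ∫ x in Ω, ψ x • gradient φ x = ∫ x, ψ x • gradient φ x :=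
  setIntegral_eq_integral_of_forall_compl_eq_zero fun x hx => by
    rw [image_eq_zero_of_notMem_tsupport fun h => hx (hψ.2.2 h), zero_smul]

theorem setIntegral_smul_gradient_eq_neg (hψ : IsTestFunction Ω ψ) (hφ : IsTestFunction Ω φ) :
    ∫ x in Ω, ψ x • gradient φ x = - ∫ x in Ω, φ x • gradient ψ x := by
  rw [hψ.setIntegral_smul_gradient, hφ.setIntegral_smul_gradient]
  exact integral_smul_gradient_eq_neg hψ.differentiable hφ.differentiable
    ((hψ.1.continuous.mul hφ.1.continuous).integrable_of_hasCompactSupport hψ.2.1.mul_right)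
    (hψ.integrable_smul_gradient hφ) (hφ.integrable_smul_gradient hψ)

end IsTestFunction

section Convergence

variable {X E F G : Type*} [MeasurableSpace X] {ν : Measure X} [NormedAddCommGroup E]
  [NormedAddCommGroup F] [NormedAddCommGroup G]

theorem tendsto_integral_bilin [NormedSpace ℝ E] [NormedSpace ℝ F] [NormedSpace ℝ G]
    [CompleteSpace G] {ι : Type*} {l : Filter ι} {p q : ENNReal} [Fact (1 ≤ p)] [Fact (1 ≤ q)]
    [p.HolderConjugate q] (B : E →L[ℝ] F →L[ℝ] G) {g : ι → X → E} {g₀ : X → E} {h : X → F}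
    (hg : ∀ k, MemLp (g k) p ν) (hg₀ : MemLp g₀ p ν) (hh : MemLp h q ν)
    (hlim : Tendsto (fun k => eLpNorm (fun x => g k x - g₀ x) p ν) l (𝓝 0)) :
    Tendsto (fun k => ∫ x, B (g k x) (h x) ∂ν) l (𝓝 (∫ x, B (g₀ x) (h x) ∂ν)) := by
  have pairing_eq : ∀ {w : X → E} (hw : MemLp w p ν),
      B.lpPairing ν p q (hw.toLp w) (hh.toLp h) = ∫ x, B (w x) (h x) ∂ν := fun hw => by
    rw [ContinuousLinearMap.lpPairing_eq_integral]
    refine integral_congr_ae ?_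
    filter_upwards [hw.coeFn_toLp, hh.coeFn_toLp] with x hx hx'
    rw [hx, hx']
  have hlim' := (Lp.tendsto_Lp_iff_tendsto_eLpNorm'' g hg g₀ hg₀).2 hlim
  simpa only [ContinuousLinearMap.flip_apply, pairing_eq, Function.comp_def] using
    (((B.lpPairing ν p q).flip (hh.toLp h)).continuous.tendsto _).comp hlim'

theorem tendsto_eLpNorm_zero_of_dominated {p : ENNReal} (hp : p ≠ ⊤) {g : ℕ → X → E} {h : X → F}
    (hg : ∀ k, AEStronglyMeasurable (g k) ν) (hh : MemLp h p ν)
    (hbound : ∀ k, ∀ᵐ x ∂ν, ‖g k x‖ ≤ ‖h x‖)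
    (hlim : ∀ᵐ x ∂ν, Tendsto (fun k => g k x) atTop (𝓝 0)) :
    Tendsto (fun k => eLpNorm (g k) p ν) atTop (𝓝 0) := by
  rcases eq_or_ne p 0 with rfl | hp0
  · simp only [eLpNorm_exponent_zero, tendsto_const_nhds]
  have hpos : 0 < p.toReal := ENNReal.toReal_pos hp0 hp
  have rpow_tendsto : ∀ {r : ℝ} {c : ℕ → ENNReal}, 0 < r → Tendsto c atTop (𝓝 0) →
      Tendsto (fun k => c k ^ r) atTop (𝓝 0) := fun {r} c hr hc => by
    simpa only [ENNReal.zero_rpow_of_pos hr, Function.comp_def] using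
      ((ENNReal.continuous_rpow_const (y := r)).tendsto 0).comp hc
  have hlintegral : Tendsto (fun k => ∫⁻ x, ‖g k x‖ₑ ^ p.toReal ∂ν) atTop (𝓝 0) := by
    rw [← lintegral_zero (μ := ν)]
    refine tendsto_lintegral_of_dominated_convergence' (fun x => ‖h x‖ₑ ^ p.toReal)
      (fun k => (hg k).enorm.pow_const _) (fun k => ?_)
      (lintegral_rpow_enorm_lt_top_of_eLpNorm_lt_top hp0 hp hh.2).ne ?_
    · filter_upwards [hbound k] with x hx
      exact ENNReal.rpow_le_rpow (enorm_le_iff_norm_le.2 hx) hpos.le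
    · filter_upwards [hlim] with x hx
      exact rpow_tendsto hpos (by simpa using hx.enorm)
  simpa only [eLpNorm_eq_lintegral_rpow_enorm_toReal hp0 hp] using
    rpow_tendsto (one_div_pos.2 hpos) hlintegral

theorem tendsto_eLpNorm_smul_sub_smul [NormedSpace ℝ F] {p : ENNReal} (hp1 : 1 ≤ p) (hp : p ≠ ⊤)
    {c : ℕ → X → ℝ} {c₀ : X → ℝ} {w : ℕ → X → F} {w₀ : X → F} {K : ℝ}
    (hc : ∀ k, AEStronglyMeasurable (c k) ν) (hK : ∀ k x, |c k x| ≤ K)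
    (hw : ∀ k, AEStronglyMeasurable (w k) ν) (hw₀ : MemLp w₀ p ν)
    (hclim : ∀ᵐ x ∂ν, Tendsto (fun k => c k x) atTop (𝓝 (c₀ x)))
    (hwlim : Tendsto (fun k => eLpNorm (fun x => w k x - w₀ x) p ν) atTop (𝓝 0)) :
    Tendsto (fun k => eLpNorm (fun x => c k x • w k x - c₀ x • w₀ x) p ν) atTop (𝓝 0) := by
  have hc₀ : AEStronglyMeasurable c₀ ν := aestronglyMeasurable_of_tendsto_ae atTop hc hclim
  have hc₀K : ∀ᵐ x ∂ν, |c₀ x| ≤ K := by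
    filter_upwards [hclim] with x hx
    exact le_of_tendsto hx.abs (Eventually.of_forall fun k => hK k x)
  have hcoeff : Tendsto (fun k => eLpNorm (fun x => (c k x - c₀ x) • w₀ x) p ν) atTop (𝓝 0) := by
    refine tendsto_eLpNorm_zero_of_dominated hp (fun k => ((hc k).sub hc₀).smul hw₀.1)
      (hw₀.const_smul (K + K)) (fun k => ?_) ?_
    · filter_upwards [hc₀K] with x hx
      simp only [Pi.smul_apply, norm_smul]
      gcongr
      exact (abs_sub _ _).trans ((add_le_add (hK k x) hx).trans (le_abs_self _))
    · filter_upwards [hclim] with x hx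
      simpa using (hx.sub_const (c₀ x)).smul_const (w₀ x)
  have hvector : Tendsto (fun k => ENNReal.ofReal K * eLpNorm (fun x => w k x - w₀ x) p ν)
      atTop (𝓝 0) := by
    simpa only [mul_zero] using ENNReal.Tendsto.const_mul hwlim (Or.inr ENNReal.ofReal_ne_top)
  refine tendsto_of_tendsto_of_tendsto_of_le_of_le tendsto_const_nhds
    (by simpa only [add_zero] using hvector.add hcoeff) (fun _ => zero_le) fun k => ?_
  have hsplit : (fun x => c k x • w k x - c₀ x • w₀ x) =
      (fun x => c k x • (w k x - w₀ x)) + fun x => (c k x - c₀ x) • w₀ x := by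
    ext1 x
    simp only [Pi.add_apply, smul_sub, sub_smul]
    abel
  rw [hsplit]
  refine (eLpNorm_add_le ((hc k).smul ((hw k).sub hw₀.1)) (((hc k).sub hc₀).smul hw₀.1)
    hp1).trans (add_le_add_left ?_ _)
  refine eLpNorm_le_mul_eLpNorm_of_ae_le_mul (Eventually.of_forall fun x => ?_) p
  simp only [Pi.smul_apply', Pi.sub_apply, norm_smul]
  gcongr
  exact hK k x

end Convergence

section SobolevSpace

variable {n : ℕ} {Ω : Set (EuclideanSpace ℝ (Fin n))} {u : EuclideanSpace ℝ (Fin n) → ℝ}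
  {Du : EuclideanSpace ℝ (Fin n) → EuclideanSpace ℝ (Fin n)}

namespace HasW012Gradient

theorem of_tendsto (hu : MemLp u 2 (volume.restrict Ω)) (hDu : MemLp Du 2 (volume.restrict Ω))
    {φ : ℕ → EuclideanSpace ℝ (Fin n) → ℝ} (hφ : ∀ k, IsTestFunction Ω (φ k))
    (hlim : Tendsto (fun k => eLpNorm (fun x => φ k x - u x) 2 (volume.restrict Ω)) atTop (𝓝 0))
    (hlim_grad : Tendsto (fun k => eLpNorm (fun x => gradient (φ k) x - Du x) 2
      (volume.restrict Ω)) atTop (𝓝 0)) : HasW012Gradient Ω u Du := by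
  refine ⟨⟨hu, hDu, fun ψ hψ => ?_⟩, φ, hφ, hlim, hlim_grad⟩
  have hleft : Tendsto (fun k => ∫ x in Ω, φ k x • gradient ψ x) atTop
      (𝓝 (∫ x in Ω, u x • gradient ψ x)) :=
    tendsto_integral_bilin (ContinuousLinearMap.lsmul ℝ ℝ) (fun k => (hφ k).memLp 2) hu
      (hψ.memLp_gradient 2) hlim
  have hright : Tendsto (fun k => ∫ x in Ω, ψ x • gradient (φ k) x) atTop
      (𝓝 (∫ x in Ω, ψ x • Du x)) :=
    tendsto_integral_bilin (ContinuousLinearMap.lsmul ℝ ℝ).flip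
      (fun k => (hφ k).memLp_gradient 2) hDu (hψ.memLp 2) hlim_grad
  simp only [(hφ _).setIntegral_smul_gradient_eq_neg hψ] at hleft
  exact tendsto_nhds_unique hleft hright.neg

theorem exists_approx_ae (hu : HasW012Gradient Ω u Du) :
    ∃ φ : ℕ → EuclideanSpace ℝ (Fin n) → ℝ, (∀ k, IsTestFunction Ω (φ k)) ∧
      Tendsto (fun k => eLpNorm (fun x => φ k x - u x) 2 (volume.restrict Ω)) atTop (𝓝 0) ∧
      Tendsto (fun k => eLpNorm (fun x => gradient (φ k) x - Du x) 2 (volume.restrict Ω))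
        atTop (𝓝 0) ∧
      ∀ᵐ x ∂(volume.restrict Ω), Tendsto (fun k => φ k x) atTop (𝓝 (u x)) := by
  obtain ⟨φ, hφ, hlim, hlim_grad⟩ := hu.exists_approx
  obtain ⟨ns, hns, hae⟩ := (tendstoInMeasure_of_tendsto_eLpNorm two_ne_zero
    (fun k => ((hφ k).memLp 2).1) hu.hasW12Gradient.memLp.1 hlim).exists_seq_tendsto_ae
  exact ⟨fun k => φ (ns k), fun k => hφ (ns k), hlim.comp hns.tendsto_atTop,
    hlim_grad.comp hns.tendsto_atTop, hae⟩

theorem comp (hu : HasW012Gradient Ω u Du) {Ψ : ℝ → ℝ} (hΨ : ContDiff ℝ (⊤ : ℕ∞) Ψ) (h0 : Ψ 0 = 0)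
    {K : ℝ} (hK : ∀ s, |deriv Ψ s| ≤ K) :
    HasW012Gradient Ω (fun x => Ψ (u x)) (fun x => deriv Ψ (u x) • Du x) := by
  obtain ⟨φ, hφ, hlim, hlim_grad, hae⟩ := hu.exists_approx_ae
  have huL := hu.hasW12Gradient.memLp
  have hdiff : Differentiable ℝ Ψ := hΨ.differentiable (by simp)
  have hcont : Continuous (deriv Ψ) := hΨ.continuous_deriv (by simp)
  have hlip : ∀ s t, ‖Ψ s - Ψ t‖ ≤ K * ‖s - t‖ := fun s t =>
    Convex.norm_image_sub_le_of_norm_deriv_le (fun x _ => hdiff x) (fun x _ => hK x) convex_univ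
      (Set.mem_univ t) (Set.mem_univ s)
  refine of_tendsto (φ := fun k x => Ψ (φ k x)) ?_ ?_ (fun k => (hφ k).comp hΨ h0) ?_ ?_
  · refine huL.of_le_mul (c := K) (hΨ.continuous.comp_aestronglyMeasurable huL.1)
      (Eventually.of_forall fun x => ?_)
    simpa only [h0, sub_zero] using hlip (u x) 0
  · refine hu.hasW12Gradient.memLp_grad.of_le_mul (c := K)
      ((hcont.comp_aestronglyMeasurable huL.1).smul hu.hasW12Gradient.memLp_grad.1)
      (Eventually.of_forall fun x => ?_)
    rw [norm_smul]
    exact mul_le_mul_of_nonneg_right (hK _) (norm_nonneg _)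
  · refine tendsto_of_tendsto_of_tendsto_of_le_of_le tendsto_const_nhds
      (by simpa only [mul_zero] using
        ENNReal.Tendsto.const_mul hlim (Or.inr (ENNReal.ofReal_ne_top (r := K))))
      (fun _ => zero_le) fun k => ?_
    exact eLpNorm_le_mul_eLpNorm_of_ae_le_mul (Eventually.of_forall fun x => hlip (φ k x) (u x)) 2
  · simp only [gradient_comp (hdiff _) ((hφ _).differentiable _)]
    refine tendsto_eLpNorm_smul_sub_smul one_le_two ENNReal.ofNat_ne_top
      (fun k => hcont.comp_aestronglyMeasurable ((hφ k).memLp 2).1) (fun k x => hK _)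
      (fun k => ((hφ k).memLp_gradient 2).1) hu.hasW12Gradient.memLp_grad ?_ hlim_grad
    filter_upwards [hae] with x hx
    exact (hcont.tendsto _).comp hx

end HasW012Gradient

/-- The constant of the Sobolev embedding `W_0^{1,2} ⊂ L^{2^*}` in dimension `n`, uniform in the
domain. -/
noncomputable def sobolevConst (n : ℕ) : NNReal :=
  eLpNormLESNormFDerivOfEqInnerConst (volume : Measure (EuclideanSpace ℝ (Fin n))) 2

theorem IsTestFunction.eLpNorm_le_sobolevConst_mul (hn : 2 < n) {φ : EuclideanSpace ℝ (Fin n) → ℝ}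
    (hφ : IsTestFunction Ω φ) :
    eLpNorm φ (ENNReal.ofReal (2 * n / (n - 2))) (volume.restrict Ω) ≤
      sobolevConst n * eLpNorm (gradient φ) 2 (volume.restrict Ω) := by
  have hn' : (0 : ℝ) < n - 2 := sub_pos.2 (by exact_mod_cast hn)
  have hexponent : ((2 * n / (n - 2) : ℝ).toNNReal : ℝ)⁻¹ =
      (2 : NNReal)⁻¹ - (Module.finrank ℝ (EuclideanSpace ℝ (Fin n)) : ℝ)⁻¹ := by
    rw [Real.coe_toNNReal _ (by positivity), finrank_euclideanSpace_fin]
    push_cast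
    field_simp
  calc eLpNorm φ (ENNReal.ofReal (2 * n / (n - 2))) (volume.restrict Ω)
      ≤ eLpNorm φ (ENNReal.ofReal (2 * n / (n - 2))) volume :=
        eLpNorm_mono_measure _ Measure.restrict_le_self
    _ ≤ sobolevConst n * eLpNorm (fderiv ℝ φ) 2 volume :=
        eLpNorm_le_eLpNorm_fderiv_of_eq_inner volume (hφ.1.of_le (by simp)) hφ.2.1 one_le_two
          (by rw [finrank_euclideanSpace_fin]; omega) hexponent
    _ = sobolevConst n * eLpNorm (gradient φ) 2 volume := by
        rw [eLpNorm_congr_norm_ae (Eventually.of_forall fun x => (norm_gradient φ x).symm)]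
    _ = sobolevConst n * eLpNorm (gradient φ) 2 (volume.restrict Ω) := by
        rw [eLpNorm_restrict_eq_of_support_subset ((support_gradient_subset φ).trans hφ.2.2)]

theorem HasW012Gradient.eLpNorm_le_sobolevConst_mul (hn : 2 < n) (hu : HasW012Gradient Ω u Du) :
    eLpNorm u (ENNReal.ofReal (2 * n / (n - 2))) (volume.restrict Ω) ≤
      sobolevConst n * eLpNorm Du 2 (volume.restrict Ω) := by
  obtain ⟨φ, hφ, -, hlim_grad, hae⟩ := hu.exists_approx_ae
  have hDu := hu.hasW12Gradient.memLp_grad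
  have hnorm_grad (k : ℕ) : eLpNorm (gradient (φ k)) 2 (volume.restrict Ω) ≤
      eLpNorm (fun x => gradient (φ k) x - Du x) 2 (volume.restrict Ω) +
        eLpNorm Du 2 (volume.restrict Ω) := by
    simpa only [sub_add_cancel] using!
      eLpNorm_add_le (((hφ k).memLp_gradient 2).1.sub hDu.1) hDu.1 one_le_two
  have hbound : Tendsto (fun k => sobolevConst n *
      (eLpNorm (fun x => gradient (φ k) x - Du x) 2 (volume.restrict Ω) +
        eLpNorm Du 2 (volume.restrict Ω))) atTop
      (𝓝 (sobolevConst n * eLpNorm Du 2 (volume.restrict Ω))) := by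
    simpa only [zero_add] using ENNReal.Tendsto.const_mul (hlim_grad.add_const _)
      (Or.inr ENNReal.coe_ne_top)
  calc eLpNorm u (ENNReal.ofReal (2 * n / (n - 2))) (volume.restrict Ω)
      ≤ liminf (fun k => eLpNorm (φ k) (ENNReal.ofReal (2 * n / (n - 2))) (volume.restrict Ω))
          atTop := Lp.eLpNorm_lim_le_liminf_eLpNorm (fun k => ((hφ k).memLp 2).1) u hae
    _ ≤ liminf (fun k => sobolevConst n *
          (eLpNorm (fun x => gradient (φ k) x - Du x) 2 (volume.restrict Ω) +
            eLpNorm Du 2 (volume.restrict Ω))) atTop :=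
        liminf_le_liminf <| Eventually.of_forall fun k =>
          ((hφ k).eLpNorm_le_sobolevConst_mul hn).trans (by gcongr; exact hnorm_grad k)
    _ = sobolevConst n * eLpNorm Du 2 (volume.restrict Ω) := hbound.liminf_eq

end SobolevSpace

section Marcinkiewicz

variable {m γ : ℝ}

theorem lintegral_Ioi_div_rpow (hm : 1 < m) (hγ : 0 ≤ γ) {s : ℝ} (hs : 0 < s) :
    ∫⁻ t in Set.Ioi s, ENNReal.ofReal (γ / t ^ m) =
      ENNReal.ofReal (γ * (s ^ (1 - m) / (m - 1))) := by
  have hintegral : ∫ t in Set.Ioi s, t ^ (-m) = s ^ (1 - m) / (m - 1) := by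
    rw [integral_Ioi_rpow_of_lt (by linarith) hs, neg_div, ← div_neg]
    ring_nf
  have hintegrable : IntegrableOn (fun t : ℝ => γ * t ^ (-m)) (Set.Ioi s) :=
    (integrableOn_Ioi_rpow_of_lt (by linarith) hs).const_mul γ
  have hnonneg : 0 ≤ᵐ[volume.restrict (Set.Ioi s)] fun t : ℝ => γ * t ^ (-m) := by
    filter_upwards [ae_restrict_mem measurableSet_Ioi] with t ht
    exact mul_nonneg hγ (Real.rpow_nonneg (hs.trans ht).le _)
  rw [← hintegral, ← integral_const_mul, ofReal_integral_eq_lintegral_ofReal hintegrable hnonneg]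
  refine setLIntegral_congr_fun measurableSet_Ioi fun t ht => ?_
  rw [Real.rpow_neg (hs.trans ht).le, div_eq_mul_inv]

variable {X E : Type*} [MeasurableSpace X] {ν : Measure X} [NormedAddCommGroup E] {f : X → E}

theorem setLIntegral_enorm_le_add_of_measure_lt_norm_le (hf : AEStronglyMeasurable f ν)
    (hm : 1 < m) (hγ : 0 ≤ γ)
    (hweak : ∀ t : ℝ, 0 < t → ν {x | t < ‖f x‖} ≤ ENNReal.ofReal (γ / t ^ m)) (A : Set X)
    {s : ℝ} (hs : 0 < s) :
    ∫⁻ x in A, ‖f x‖ₑ ∂ν ≤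
      ν A * ENNReal.ofReal s + ENNReal.ofReal (γ * (s ^ (1 - m) / (m - 1))) :=
  calc ∫⁻ x in A, ‖f x‖ₑ ∂ν = ∫⁻ x in A, ENNReal.ofReal ‖f x‖ ∂ν := by simp only [ofReal_norm]
    _ = ∫⁻ t in Set.Ioi 0, ν.restrict A {x | t < ‖f x‖} :=
        lintegral_eq_lintegral_meas_lt _ (Eventually.of_forall fun x => norm_nonneg _)
          hf.restrict.norm.aemeasurable
    _ ≤ (∫⁻ t in Set.Ioc 0 s, ν.restrict A {x | t < ‖f x‖}) +
          ∫⁻ t in Set.Ioi s, ν.restrict A {x | t < ‖f x‖} := by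
        rw [← Set.Ioc_union_Ioi_eq_Ioi hs.le]
        exact lintegral_union_le _ _ _
    _ ≤ (∫⁻ _ in Set.Ioc 0 s, ν A) + ∫⁻ t in Set.Ioi s, ENNReal.ofReal (γ / t ^ m) := by
        refine add_le_add (lintegral_mono fun t => ?_)
          (setLIntegral_mono' measurableSet_Ioi fun t ht => ?_)
        · exact (measure_mono (Set.subset_univ _)).trans_eq (Measure.restrict_apply_univ A)
        · exact (Measure.restrict_le_self _).trans (hweak t (hs.trans ht))
    _ = ν A * ENNReal.ofReal s + ENNReal.ofReal (γ * (s ^ (1 - m) / (m - 1))) := by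
        rw [lintegral_Ioi_div_rpow hm hγ hs, setLIntegral_const, Real.volume_Ioc, sub_zero]

theorem setLIntegral_enorm_le_of_measure_lt_norm_le (hf : AEStronglyMeasurable f ν)
    (hm : 1 < m) (hγ : 0 < γ)
    (hweak : ∀ t : ℝ, 0 < t → ν {x | t < ‖f x‖} ≤ ENNReal.ofReal (γ / t ^ m)) {A : Set X}
    (hA : ν A ≠ ⊤) :
    ∫⁻ x in A, ‖f x‖ₑ ∂ν ≤
      ENNReal.ofReal (m / (m - 1) * γ ^ (1 / m) * ν.real A ^ (1 - 1 / m)) := by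
  rcases eq_or_ne (ν A) 0 with hA0 | hA0
  · exact (setLIntegral_measure_zero _ _ hA0).trans_le zero_le
  have hV : 0 < ν.real A := ENNReal.toReal_pos hA0 hA
  have hm1 : 0 < m - 1 := sub_pos.2 hm
  have hm0 : m ≠ 0 := by linarith
  -- `s` is the level at which the two summands of the splitting balance.
  set s := (γ / ν.real A) ^ (1 / m) with hs
  have hs0 : 0 < s := Real.rpow_pos_of_pos (div_pos hγ hV) _
  have hsm : s ^ m = γ / ν.real A := by
    rw [hs, ← Real.rpow_mul (div_pos hγ hV).le, one_div_mul_cancel hm0, Real.rpow_one]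
  have hVs : ν.real A * s = γ ^ (1 / m) * ν.real A ^ (1 - 1 / m) := by
    rw [hs, Real.div_rpow hγ.le hV.le, Real.rpow_sub hV, Real.rpow_one]
    ring
  have htail : γ * (s ^ (1 - m) / (m - 1)) = ν.real A * s / (m - 1) := by
    rw [Real.rpow_sub hs0, Real.rpow_one, hsm]
    field_simp
  refine (setLIntegral_enorm_le_add_of_measure_lt_norm_le hf hm hγ.le hweak A hs0).trans_eq ?_
  rw [← ofReal_measureReal hA, ← ENNReal.ofReal_mul hV.le, htail,
    ← ENNReal.ofReal_add (by positivity) (by positivity), mul_assoc, ← hVs]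
  congr 1
  field_simp
  ring

end Marcinkiewicz

theorem exists_pos_le_rpow {a : ℝ} (ha : 0 < a) (x : ℝ) : ∃ d, 0 < d ∧ x ≤ d ^ a :=
  ((eventually_gt_atTop 0).and ((tendsto_rpow_atTop ha).eventually_ge_atTop x)).exists

/-- Stampacchia's hypothesis on a function of a level: `φ` is nonnegative and nonincreasing, and
`φ (k + δ) ≤ D δ^{-a} φ(k)^b` for `k ≥ 0` and `δ > 0`. -/
structure LevelDecay (D a b : ℝ) (φ : ℝ → ℝ) : Prop where
  nonneg : ∀ t, 0 ≤ φ t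
  antitone : Antitone φ
  le_rpow : ∀ k δ, 0 ≤ k → 0 < δ → φ (k + δ) ≤ D * δ ^ (-a) * φ k ^ b

namespace LevelDecay

variable {D a b V : ℝ} {φ : ℝ → ℝ}

theorem le_geometric (h : LevelDecay D a b φ) (hD : 0 ≤ D) (hb : 1 < b) {d : ℝ} (hd : 0 < d)
    (hV : φ 0 ≤ V) (hdV : D * 2 ^ (a * b / (b - 1)) * V ^ (b - 1) ≤ d ^ a) (j : ℕ) :
    φ (d * (1 - 2 ^ (-j : ℝ))) ≤ V * 2 ^ (-(a / (b - 1) * j)) := by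
  have hV0 : 0 ≤ V := (h.nonneg 0).trans hV
  have hb1 : b - 1 ≠ 0 := by linarith
  induction j with
  | zero => simpa using hV
  | succ j ih =>
    have hstep : d * (1 - 2 ^ (-j : ℝ)) + d * 2 ^ (-(j + 1) : ℝ) =
        d * (1 - 2 ^ (-(j + 1) : ℝ)) := by
      rw [neg_add, Real.rpow_add two_pos, Real.rpow_neg_one]
      ring
    have hlevel : 0 ≤ d * (1 - (2 : ℝ) ^ (-j : ℝ)) :=
      mul_nonneg hd.le (sub_nonneg.2 (Real.rpow_le_one_of_one_le_of_nonpos one_le_two (by simp)))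
    have hVb : V ^ b = V * V ^ (b - 1) := by
      rw [← Real.rpow_one_add' hV0 (by linarith)]
      ring_nf
    have hD_le : D * d ^ (-a) * V ^ (b - 1) ≤ 2 ^ (-(a * b / (b - 1))) := by
      rw [Real.rpow_neg hd.le, Real.rpow_neg two_pos.le, ← one_div (2 ^ _),
        le_div_iff₀ (Real.rpow_pos_of_pos two_pos _)]
      calc D * (d ^ a)⁻¹ * V ^ (b - 1) * 2 ^ (a * b / (b - 1))
          = (D * 2 ^ (a * b / (b - 1)) * V ^ (b - 1)) / d ^ a := by ring
        _ ≤ 1 := div_le_one_of_le₀ hdV (by positivity)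
    push_cast
    calc φ (d * (1 - 2 ^ (-(j + 1) : ℝ)))
        ≤ D * (d * 2 ^ (-(j + 1) : ℝ)) ^ (-a) * φ (d * (1 - 2 ^ (-j : ℝ))) ^ b :=
          hstep ▸ h.le_rpow _ _ hlevel (by positivity)
      _ ≤ D * (d * 2 ^ (-(j + 1) : ℝ)) ^ (-a) * (V * 2 ^ (-(a / (b - 1) * j))) ^ b := by
          gcongr
          exact h.nonneg _
      _ = D * d ^ (-a) * V ^ (b - 1) *
            (V * 2 ^ (-(j + 1) * (-a) + -(a / (b - 1) * j) * b)) := by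
          rw [Real.mul_rpow hd.le (by positivity), Real.mul_rpow hV0 (by positivity), hVb,
            ← Real.rpow_mul two_pos.le, ← Real.rpow_mul two_pos.le, Real.rpow_add two_pos]
          ring
      _ ≤ 2 ^ (-(a * b / (b - 1))) *
            (V * 2 ^ (-(j + 1) * (-a) + -(a / (b - 1) * j) * b)) := by gcongr
      _ = V * 2 ^ (-(a / (b - 1) * (j + 1))) := by
          rw [mul_left_comm, ← Real.rpow_add two_pos]
          congr 2
          field_simp
          ring

theorem eq_zero (h : LevelDecay D a b φ) (hD : 0 ≤ D) (ha : 0 < a) (hb : 1 < b) {d : ℝ}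
    (hd : 0 < d) (hV : φ 0 ≤ V) (hdV : D * 2 ^ (a * b / (b - 1)) * V ^ (b - 1) ≤ d ^ a) :
    φ d = 0 := by
  have hlt : (2 : ℝ) ^ (-(a / (b - 1))) < 1 :=
    Real.rpow_lt_one_of_one_lt_of_neg one_lt_two (neg_lt_zero.2 (div_pos ha (sub_pos.2 hb)))
  have hlim : Tendsto (fun j : ℕ => V * (2 : ℝ) ^ (-(a / (b - 1) * j))) atTop (𝓝 0) := by
    simpa only [← neg_mul, Real.rpow_mul two_pos.le, Real.rpow_natCast, mul_zero] using
      (tendsto_pow_atTop_nhds_zero_of_lt_one (by positivity) hlt).const_mul V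
  refine le_antisymm (ge_of_tendsto' hlim fun j => ?_) (h.nonneg d)
  refine (h.antitone ?_).trans (h.le_geometric hD hb hd hV hdV j)
  exact mul_le_of_le_one_right hd.le (sub_le_self _ (by positivity))

theorem exists_forall_eq_zero (hD : 0 ≤ D) (ha : 0 < a) (hb : 1 < b) (V : ℝ) :
    ∃ d, 0 < d ∧ ∀ φ : ℝ → ℝ, LevelDecay D a b φ → φ 0 ≤ V → φ d = 0 := by
  obtain ⟨d, hd, hdV⟩ := exists_pos_le_rpow ha (D * 2 ^ (a * b / (b - 1)) * V ^ (b - 1))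
  exact ⟨d, hd, fun φ h hV => h.eq_zero hD ha hb hd hV hdV⟩

theorem natCast_mul_le_exp (h : LevelDecay D a 1 φ) {τ : ℝ} (hτ : 0 < τ)
    (hDτ : D * Real.exp 1 ≤ τ ^ a) (j : ℕ) : φ (j * τ) ≤ φ 0 * Real.exp (-j) := by
  induction j with
  | zero => simp
  | succ j ih =>
    have hDτ' : D * τ ^ (-a) ≤ Real.exp (-1) := by
      rw [Real.rpow_neg hτ.le, Real.exp_neg]
      have := Real.rpow_pos_of_pos hτ a
      field_simp
      linarith
    calc φ ((j + 1 : ℕ) * τ) = φ (j * τ + τ) := by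
          push_cast
          ring_nf
      _ ≤ D * τ ^ (-a) * φ (j * τ) := by
          simpa only [Real.rpow_one] using h.le_rpow (j * τ) τ (by positivity) hτ
      _ ≤ Real.exp (-1) * (φ 0 * Real.exp (-j)) :=
          mul_le_mul hDτ' ih (h.nonneg _) (Real.exp_pos _).le
      _ = φ 0 * Real.exp (-(j + 1 : ℕ)) := by
          rw [mul_left_comm, ← Real.exp_add]
          push_cast
          ring_nf

theorem exists_le_exp (h : LevelDecay D a 1 φ) (ha : 0 < a) :
    ∃ τ, 0 < τ ∧ ∀ t, 0 ≤ t → φ t ≤ φ 0 * Real.exp (1 - t / τ) := by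
  obtain ⟨τ, hτ, hDτ⟩ := exists_pos_le_rpow ha (D * Real.exp 1)
  refine ⟨τ, hτ, fun t ht => ?_⟩
  have hfloor : ⌊t / τ⌋₊ * τ ≤ t := (le_div_iff₀ hτ).1 (Nat.floor_le (div_nonneg ht hτ.le))
  refine (h.antitone hfloor).trans ((h.natCast_mul_le_exp hτ hDτ _).trans ?_)
  gcongr
  · exact h.nonneg 0
  · linarith [Nat.lt_floor_add_one (t / τ)]

theorem rpow_mul_le (h : LevelDecay D a b φ) (hD : 0 ≤ D) (ha : 0 ≤ a) (hb0 : 0 ≤ b) (hb : b < 1)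
    (hV : φ 0 ≤ V) (hDV : D * 2 ^ (a / (1 - b)) * V ^ b ≤ V) {t : ℝ} (ht : 0 < t) :
    t ^ (a / (1 - b)) * φ t ≤ V := by
  have hq : 0 ≤ a / (1 - b) := div_nonneg ha (by linarith)
  have hqb : a / (1 - b) + -a = a / (1 - b) * b := by
    have : 1 - b ≠ 0 := by linarith
    field_simp
    ring
  set q := a / (1 - b)
  have hdyadic : ∀ (j : ℕ) {t : ℝ}, 0 < t → t ≤ 2 ^ j → t ^ q * φ t ≤ V := by
    intro j
    induction j with
    | zero =>
      intro t ht ht1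
      have htq : t ^ q ≤ 1 := Real.rpow_le_one ht.le (by simpa using ht1) hq
      exact (mul_le_of_le_one_left (h.nonneg t) htq).trans ((h.antitone ht.le).trans hV)
    | succ j ih =>
      intro t ht htj
      obtain ⟨s, rfl⟩ : ∃ s, t = s + s := ⟨t / 2, (add_halves t).symm⟩
      have hs : 0 < s := by linarith
      have hφs := h.nonneg s
      calc (s + s) ^ q * φ (s + s) ≤ (s + s) ^ q * (D * s ^ (-a) * φ s ^ b) := by
            gcongr
            exact h.le_rpow s s hs.le hs
        _ = D * 2 ^ q * (s ^ q * φ s) ^ b := by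
            rw [Real.mul_rpow (by positivity) hφs, ← Real.rpow_mul hs.le, ← hqb,
              Real.rpow_add hs, ← two_mul, Real.mul_rpow two_pos.le hs.le]
            ring
        _ ≤ D * 2 ^ q * V ^ b := by
            gcongr
            exact ih hs (by rw [pow_succ] at htj; linarith)
        _ ≤ V := hDV
  obtain ⟨j, hj⟩ := pow_unbounded_of_one_lt t one_lt_two
  exact hdyadic j ht hj.le

theorem exists_le_rpow (h : LevelDecay D a b φ) (hD : 0 ≤ D) (ha : 0 ≤ a) (hb0 : 0 ≤ b)
    (hb : b < 1) : ∃ C : ℝ, ∀ t, 0 < t → φ t ≤ C / t ^ (a / (1 - b)) := by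
  have hb1 : 0 < 1 - b := sub_pos.2 hb
  have hφ0 := h.nonneg 0
  set c := D * 2 ^ (a / (1 - b))
  have hc : 0 ≤ c := by positivity
  set V := φ 0 + c ^ (1 / (1 - b))
  have hV : 0 ≤ V := by positivity
  have hcV : c ≤ V ^ (1 - b) := by
    calc c = (c ^ (1 / (1 - b))) ^ (1 - b) := by
          rw [← Real.rpow_mul hc, one_div_mul_cancel hb1.ne', Real.rpow_one]
      _ ≤ V ^ (1 - b) := by
          gcongr
          exact le_add_of_nonneg_left hφ0
  have hDV : c * V ^ b ≤ V :=
    calc c * V ^ b ≤ V ^ (1 - b) * V ^ b := by gcongr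
      _ = V := by rw [← Real.rpow_add' hV (by simp), sub_add_cancel, Real.rpow_one]
  refine ⟨V, fun t ht => ?_⟩
  rw [le_div_iff₀ (Real.rpow_pos_of_pos ht _), mul_comm]
  exact h.rpow_mul_le hD ha hb0 hb (le_add_of_nonneg_right (by positivity)) hDV ht

end LevelDecay

/-- The weight `(1 + |s|)^θ ln^θ(e + |s|)` by which the lower bound of the coefficient
degenerates. -/
noncomputable def degeneracyWeight (θ s : ℝ) : ℝ :=
  (1 + |s|) ^ θ * Real.log (Real.exp 1 + |s|) ^ θ

theorem one_le_log_exp_one_add_abs (s : ℝ) : 1 ≤ Real.log (Real.exp 1 + |s|) := by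
  rw [Real.le_log_iff_exp_le (by positivity)]
  exact le_add_of_nonneg_right (abs_nonneg s)

theorem degeneracyWeight_pos (θ s : ℝ) : 0 < degeneracyWeight θ s :=
  mul_pos (Real.rpow_pos_of_pos (by positivity) θ)
    (Real.rpow_pos_of_pos (one_pos.trans_le (one_le_log_exp_one_add_abs s)) θ)

theorem one_le_degeneracyWeight {θ : ℝ} (hθ : 0 ≤ θ) (s : ℝ) : 1 ≤ degeneracyWeight θ s :=
  one_le_mul_of_one_le_of_one_le
    (Real.one_le_rpow (le_add_of_nonneg_right (abs_nonneg s)) hθ)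
    (Real.one_le_rpow (one_le_log_exp_one_add_abs s) hθ)

/-- A smooth nondecreasing function `G` with `G 0 = 0` whose slope is at most `K` divided by the
degeneracy weight. If `u` solves the equation, bounded functions of `G(u)` are test functions whose
energy is controlled in spite of the degeneracy. -/
structure IsAdmissibleProfile (K θ : ℝ) (G : ℝ → ℝ) : Prop where
  contDiff : ContDiff ℝ (⊤ : ℕ∞) G
  map_zero : G 0 = 0
  deriv_nonneg : ∀ s, 0 ≤ deriv G s
  deriv_le : ∀ s, deriv G s ≤ K / degeneracyWeight θ s

namespace IsAdmissibleProfile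

variable {K θ : ℝ} {G : ℝ → ℝ}

theorem nonneg (hG : IsAdmissibleProfile K θ G) : 0 ≤ K := by
  have h := (hG.deriv_nonneg 0).trans (hG.deriv_le 0)
  rwa [le_div_iff₀ (degeneracyWeight_pos θ 0), zero_mul] at h

theorem abs_deriv_le (hG : IsAdmissibleProfile K θ G) (hθ : 0 ≤ θ) (s : ℝ) : |deriv G s| ≤ K := by
  rw [abs_of_nonneg (hG.deriv_nonneg s)]
  exact (hG.deriv_le s).trans (div_le_self hG.nonneg (one_le_degeneracyWeight hθ s))

variable {E : Type*} [NormedAddCommGroup E] [InnerProductSpace ℝ E]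

theorem mul_inner_deriv_smul_nonneg (hG : IsAdmissibleProfile K θ G) {c : ℝ} (hc : 0 ≤ c) (s : ℝ)
    (ξ : E) : 0 ≤ c * inner ℝ ξ (deriv G s • ξ) := by
  rw [inner_smul_right]
  exact mul_nonneg hc (mul_nonneg (hG.deriv_nonneg s) real_inner_self_nonneg)

theorem norm_deriv_smul_sq_le (hG : IsAdmissibleProfile K θ G) {α c s : ℝ} (hα : 0 < α)
    (hc : α / degeneracyWeight θ s ≤ c) (ξ : E) :
    ‖deriv G s • ξ‖ ^ 2 ≤ K / α * (c * inner ℝ ξ (deriv G s • ξ)) := by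
  have hK := hG.nonneg
  have hG' := hG.deriv_nonneg s
  have hslope : deriv G s ≤ K / α * c :=
    calc deriv G s ≤ K / degeneracyWeight θ s := hG.deriv_le s
      _ = K / α * (α / degeneracyWeight θ s) := by field_simp
      _ ≤ K / α * c := by gcongr
  calc ‖deriv G s • ξ‖ ^ 2 = deriv G s * (deriv G s * ‖ξ‖ ^ 2) := by
        rw [norm_smul, Real.norm_of_nonneg hG']
        ring
    _ ≤ K / α * c * (deriv G s * ‖ξ‖ ^ 2) := by gcongr
    _ = K / α * (c * inner ℝ ξ (deriv G s • ξ)) := by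
        rw [inner_smul_right, real_inner_self_eq_norm_sq, mul_assoc]

end IsAdmissibleProfile

section OddCutoff

/-- The maximal slope of `Real.smoothTransition`. -/
noncomputable def transitionSlope : ℝ := ⨆ x, deriv Real.smoothTransition x

theorem deriv_smoothTransition_eq_zero {x : ℝ} (hx : x ∉ Set.Icc (0 : ℝ) 1) :
    deriv Real.smoothTransition x = 0 := by
  rw [Set.mem_Icc, not_and_or, not_le, not_le] at hx
  rcases hx with hx | hx
  · have : Real.smoothTransition =ᶠ[𝓝 x] fun _ => 0 := by
      filter_upwards [eventually_lt_nhds hx] with y hy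
      exact Real.smoothTransition.zero_of_nonpos hy.le
    rw [this.deriv_eq, deriv_const]
  · have : Real.smoothTransition =ᶠ[𝓝 x] fun _ => 1 := by
      filter_upwards [eventually_gt_nhds hx] with y hy
      exact Real.smoothTransition.one_of_one_le hy.le
    rw [this.deriv_eq, deriv_const]

theorem deriv_smoothTransition_le_transitionSlope (x : ℝ) :
    deriv Real.smoothTransition x ≤ transitionSlope := by
  have hcont : Continuous (deriv Real.smoothTransition) :=
    (Real.smoothTransition.contDiff (n := 1)).continuous_deriv le_rfl
  obtain ⟨M, hM⟩ := hcont.bounded_above_of_compact_support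
    (HasCompactSupport.intro isCompact_Icc fun _ => deriv_smoothTransition_eq_zero)
  exact le_ciSup ⟨M, Set.forall_mem_range.2 fun y => (le_abs_self _).trans (hM y)⟩ x

theorem transitionSlope_nonneg : 0 ≤ transitionSlope :=
  Real.iSup_nonneg fun _ => Real.smoothTransition.monotone.deriv_nonneg

/-- A smooth odd cutoff, vanishing on `[-k, k]` and equal to `±1` outside `(-(k + δ), k + δ)`. It
replaces Stampacchia's truncation `T_δ(s - T_k(s)) / δ`, so that the chain rule in `W_0^{1,2}` is
needed for smooth functions only. -/
noncomputable def oddCutoff (k δ s : ℝ) : ℝ :=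
  Real.smoothTransition ((s - k) / δ) - Real.smoothTransition ((-s - k) / δ)

variable {k δ s : ℝ}

theorem contDiff_oddCutoff : ContDiff ℝ (⊤ : ℕ∞) (oddCutoff k δ) :=
  (Real.smoothTransition.contDiff.comp (by fun_prop)).sub
    (Real.smoothTransition.contDiff.comp (by fun_prop))

theorem oddCutoff_eq_zero (hδ : 0 < δ) (hs : |s| ≤ k) : oddCutoff k δ s = 0 := by
  obtain ⟨h1, h2⟩ := abs_le.1 hs
  rw [oddCutoff, Real.smoothTransition.zero_of_nonpos (div_nonpos_of_nonpos_of_nonneg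
    (by linarith) hδ.le), Real.smoothTransition.zero_of_nonpos (div_nonpos_of_nonpos_of_nonneg
    (by linarith) hδ.le), sub_zero]

theorem abs_oddCutoff_le_one (k δ s : ℝ) : |oddCutoff k δ s| ≤ 1 := by
  rw [oddCutoff, abs_le]
  constructor <;> linarith [Real.smoothTransition.le_one ((s - k) / δ),
    Real.smoothTransition.nonneg ((s - k) / δ), Real.smoothTransition.le_one ((-s - k) / δ),
    Real.smoothTransition.nonneg ((-s - k) / δ)]

theorem abs_oddCutoff_eq_one (hk : 0 ≤ k) (hδ : 0 < δ) (hs : k + δ ≤ |s|) :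
    |oddCutoff k δ s| = 1 := by
  rcases le_abs.1 hs with h | h
  · rw [oddCutoff, Real.smoothTransition.one_of_one_le (by rw [le_div_iff₀ hδ]; linarith),
      Real.smoothTransition.zero_of_nonpos (div_nonpos_of_nonpos_of_nonneg (by linarith) hδ.le),
      sub_zero, abs_one]
  · rw [oddCutoff, Real.smoothTransition.one_of_one_le (x := (-s - k) / δ)
      (by rw [le_div_iff₀ hδ]; linarith),
      Real.smoothTransition.zero_of_nonpos (div_nonpos_of_nonpos_of_nonneg (by linarith) hδ.le),
      zero_sub, abs_neg, abs_one]

theorem hasDerivAt_oddCutoff (k δ s : ℝ) :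
    HasDerivAt (oddCutoff k δ) ((deriv Real.smoothTransition ((s - k) / δ) +
      deriv Real.smoothTransition ((-s - k) / δ)) / δ) s := by
  have hdiff : Differentiable ℝ Real.smoothTransition :=
    (Real.smoothTransition.contDiff (n := 1)).differentiable one_ne_zero
  have hright := (hdiff ((s - k) / δ)).hasDerivAt.comp s
    (((hasDerivAt_id s).sub_const k).div_const δ)
  have hleft := (hdiff ((-s - k) / δ)).hasDerivAt.comp s
    (((hasDerivAt_id s).neg.sub_const k).div_const δ)
  convert! hright.sub hleft using 1
  ring

theorem deriv_oddCutoff_nonneg (hδ : 0 ≤ δ) : 0 ≤ deriv (oddCutoff k δ) s := by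
  rw [(hasDerivAt_oddCutoff k δ s).deriv]
  exact div_nonneg (add_nonneg Real.smoothTransition.monotone.deriv_nonneg
    Real.smoothTransition.monotone.deriv_nonneg) hδ

theorem deriv_oddCutoff_le (hδ : 0 ≤ δ) :
    deriv (oddCutoff k δ) s ≤ 2 * transitionSlope / δ := by
  rw [(hasDerivAt_oddCutoff k δ s).deriv, two_mul]
  gcongr <;> exact deriv_smoothTransition_le_transitionSlope _

theorem IsAdmissibleProfile.oddCutoff_comp {K θ : ℝ} {G : ℝ → ℝ} (hG : IsAdmissibleProfile K θ G)
    (hk : 0 ≤ k) (hδ : 0 < δ) :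
    IsAdmissibleProfile (2 * transitionSlope / δ * K) θ fun s => oddCutoff k δ (G s) := by
  have hderiv (s : ℝ) : deriv (fun s => oddCutoff k δ (G s)) s =
      deriv (oddCutoff k δ) (G s) * deriv G s :=
    ((contDiff_oddCutoff.differentiable (by simp) (G s)).hasDerivAt.comp s
      (hG.contDiff.differentiable (by simp) s).hasDerivAt).deriv
  refine ⟨contDiff_oddCutoff.comp hG.contDiff, oddCutoff_eq_zero hδ ?_, fun s => ?_, fun s => ?_⟩
  · rwa [hG.map_zero, abs_zero]
  · rw [hderiv]
    exact mul_nonneg (deriv_oddCutoff_nonneg hδ.le) (hG.deriv_nonneg s)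
  · rw [hderiv, mul_div_assoc]
    exact mul_le_mul (deriv_oddCutoff_le hδ.le) (hG.deriv_le s) (hG.deriv_nonneg s)
      (div_nonneg (mul_nonneg two_pos.le transitionSlope_nonneg) hδ.le)

end OddCutoff

section WeakSolution

variable {n : ℕ} {Ω : Set (EuclideanSpace ℝ (Fin n))} {α β θ m γ : ℝ}
  {a : EuclideanSpace ℝ (Fin n) → ℝ → ℝ} {f u : EuclideanSpace ℝ (Fin n) → ℝ}
  {Du : EuclideanSpace ℝ (Fin n) → EuclideanSpace ℝ (Fin n)}

/-- `u ∈ W_0^{1,2}(Ω)`, with weak gradient `Du`, solves `-div(a(x, u) Du) = f` in `Ω` when tested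
with bounded functions of `W_0^{1,2}(Ω)`. Bounded test functions suffice for the estimates, and
against them the right-hand side converges for every integrable `f`. -/
structure IsBoundedTestSolution (Ω : Set (EuclideanSpace ℝ (Fin n)))
    (a : EuclideanSpace ℝ (Fin n) → ℝ → ℝ) (f u : EuclideanSpace ℝ (Fin n) → ℝ)
    (Du : EuclideanSpace ℝ (Fin n) → EuclideanSpace ℝ (Fin n)) : Prop where
  hasW012Gradient : HasW012Gradient Ω u Du
  integral_eq : ∀ (v : EuclideanSpace ℝ (Fin n) → ℝ)
    (Dv : EuclideanSpace ℝ (Fin n) → EuclideanSpace ℝ (Fin n)), HasW012Gradient Ω v Dv →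
    (∃ C, ∀ x, |v x| ≤ C) → ∫ x in Ω, a x (u x) * inner ℝ (Du x) (Dv x) = ∫ x in Ω, f x * v x

theorem IsWeakSolution.exists_isBoundedTestSolution (hu : IsWeakSolution Ω a f u) :
    ∃ Du, IsBoundedTestSolution Ω a f u Du :=
  hu.imp fun _ h => ⟨h.1, fun v Dv hv _ => h.2 v Dv hv⟩

theorem HasW012Gradient.aemeasurable (hu : HasW012Gradient Ω u Du) :
    AEMeasurable u (volume.restrict Ω) :=
  hu.hasW12Gradient.memLp.1.aemeasurable

theorem IsCaratheodory.aemeasurable_comp (ha : IsCaratheodory Ω a)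
    (hu : AEMeasurable u (volume.restrict Ω)) :
    AEMeasurable (fun x => a x (u x)) (volume.restrict Ω) := by
  have hsm := hu.measurable_mk.stronglyMeasurable
  refine aemeasurable_of_tendsto_metrizable_ae atTop (f := fun k x => a x (hsm.approx k x))
    (fun k => ⟨fun x => (ha.aemeasurable (hsm.approx k x)).mk _ x,
      (hsm.approx k).measurable_bind (fun c x => (ha.aemeasurable c).mk _ x)
        fun c => (ha.aemeasurable c).measurable_mk, ?_⟩) ?_
  · have hvalues := (ae_ball_iff (hsm.approx k).finite_range.countable).2
      fun c _ => (ha.aemeasurable c).ae_eq_mk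
    filter_upwards [hvalues] with x hx
    exact hx _ ⟨x, rfl⟩
  · filter_upwards [ha.continuous, hu.ae_eq_mk] with x hx hux
    rw [hux]
    exact (hx.tendsto _).comp (hsm.tendsto_approx x)

theorem DegenerateBounds.ae_nonneg (hab : DegenerateBounds Ω α β θ a) (hα : 0 ≤ α) :
    ∀ᵐ x ∂(volume.restrict Ω), ∀ s, 0 ≤ a x s := by
  filter_upwards [hab] with x hx s
  exact (div_nonneg hα (degeneracyWeight_pos θ s).le).trans (hx s).1

theorem DegenerateBounds.integrable_mul_inner (hab : DegenerateBounds Ω α β θ a) (hα : 0 ≤ α)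
    (ha : IsCaratheodory Ω a) (hu : AEMeasurable u (volume.restrict Ω))
    {F H : EuclideanSpace ℝ (Fin n) → EuclideanSpace ℝ (Fin n)}
    (hF : MemLp F 2 (volume.restrict Ω)) (hH : MemLp H 2 (volume.restrict Ω)) :
    Integrable (fun x => a x (u x) * inner ℝ (F x) (H x)) (volume.restrict Ω) := by
  have hinner : Integrable (fun x => inner ℝ (F x) (H x)) (volume.restrict Ω) :=
    memLp_one_iff_integrable.1 ((innerSL ℝ).memLp_of_bilin 1 hF hH)
  refine hinner.bdd_mul (c := β) (ha.aemeasurable_comp hu).aestronglyMeasurable ?_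
  filter_upwards [hab, hab.ae_nonneg hα] with x hx hx0
  rw [Real.norm_of_nonneg (hx0 _)]
  exact (hx (u x)).2

theorem ofReal_setIntegral_mul_le (f v : EuclideanSpace ℝ (Fin n) → ℝ) :
    ENNReal.ofReal (∫ x in Ω, f x * v x) ≤ ∫⁻ x in Ω, ‖f x‖ₑ * ‖v x‖ₑ := by
  simp only [← enorm_mul]
  exact (Real.ofReal_le_enorm _).trans (enorm_integral_le_lintegral_enorm _)

theorem IsBoundedTestSolution.lintegral_enorm_sq_le (hu : IsBoundedTestSolution Ω a f u Du)
    (hα : 0 < α) (hθ : 0 ≤ θ) (ha : IsCaratheodory Ω a) (hab : DegenerateBounds Ω α β θ a)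
    {K C : ℝ} {Ψ : ℝ → ℝ} (hΨ : IsAdmissibleProfile K θ Ψ) (hC : ∀ s, |Ψ s| ≤ C) :
    ∫⁻ x in Ω, ‖deriv Ψ (u x) • Du x‖ₑ ^ 2 ≤
      ENNReal.ofReal (K / α) * ∫⁻ x in Ω, ‖f x‖ₑ * ‖Ψ (u x)‖ₑ := by
  have hv := hu.hasW012Gradient.comp hΨ.contDiff hΨ.map_zero (hΨ.abs_deriv_le hθ)
  set energy := fun x => a x (u x) * inner ℝ (Du x) (deriv Ψ (u x) • Du x)
  have henergy : Integrable energy (volume.restrict Ω) :=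
    hab.integrable_mul_inner hα.le ha hu.hasW012Gradient.aemeasurable
      hu.hasW012Gradient.hasW12Gradient.memLp_grad hv.hasW12Gradient.memLp_grad
  have henergy_nonneg : 0 ≤ᵐ[volume.restrict Ω] energy := by
    filter_upwards [hab.ae_nonneg hα.le] with x hx
    exact hΨ.mul_inner_deriv_smul_nonneg (hx _) _ _
  have hle : ∀ᵐ x ∂(volume.restrict Ω), ‖deriv Ψ (u x) • Du x‖ₑ ^ 2 ≤
      ENNReal.ofReal (K / α) * ENNReal.ofReal (energy x) := by
    filter_upwards [hab] with x hx
    rw [← ENNReal.ofReal_mul (div_nonneg hΨ.nonneg hα.le), ← ofReal_norm,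
      ← ENNReal.ofReal_pow (norm_nonneg _)]
    exact ENNReal.ofReal_le_ofReal (hΨ.norm_deriv_smul_sq_le hα (hx (u x)).1 _)
  calc ∫⁻ x in Ω, ‖deriv Ψ (u x) • Du x‖ₑ ^ 2
      ≤ ∫⁻ x in Ω, ENNReal.ofReal (K / α) * ENNReal.ofReal (energy x) := lintegral_mono_ae hle
    _ = ENNReal.ofReal (K / α) * ENNReal.ofReal (∫ x in Ω, energy x) := by
        rw [lintegral_const_mul' _ _ ENNReal.ofReal_ne_top,
          ofReal_integral_eq_lintegral_ofReal henergy henergy_nonneg]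
    _ ≤ ENNReal.ofReal (K / α) * ∫⁻ x in Ω, ‖f x‖ₑ * ‖Ψ (u x)‖ₑ := by
        rw [hu.integral_eq _ _ hv ⟨C, fun x => hC (u x)⟩]
        gcongr
        exact ofReal_setIntegral_mul_le _ _

theorem HasW012Gradient.measure_one_le_abs_le (hn : 2 < n) (hu : HasW012Gradient Ω u Du) :
    volume.restrict Ω {x | 1 ≤ |u x|} ≤
      ((sobolevConst n : ENNReal) ^ 2 * ∫⁻ x in Ω, ‖Du x‖ₑ ^ 2) ^ ((n : ℝ) / (n - 2)) := by
  have hn2 : (0 : ℝ) < n - 2 := sub_pos.2 (by exact_mod_cast hn)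
  have hp : 0 < 2 * (n : ℝ) / (n - 2) := by positivity
  have hchebyshev := mul_meas_ge_le_pow_eLpNorm' (volume.restrict Ω)
    (ENNReal.ofReal_pos.2 hp).ne' ENNReal.ofReal_ne_top hu.hasW12Gradient.memLp.1 1
  simp only [ENNReal.one_rpow, one_mul, ENNReal.toReal_ofReal hp.le, ← ofReal_norm,
    ENNReal.one_le_ofReal, Real.norm_eq_abs] at hchebyshev
  have hsq : eLpNorm Du 2 (volume.restrict Ω) ^ 2 = ∫⁻ x in Ω, ‖Du x‖ₑ ^ 2 := by
    rw [eLpNorm_eq_lintegral_rpow_enorm_toReal two_ne_zero ENNReal.ofNat_ne_top,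
      ENNReal.toReal_ofNat, ← ENNReal.rpow_natCast, ← ENNReal.rpow_mul]
    norm_num
  calc volume.restrict Ω {x | 1 ≤ |u x|}
      ≤ eLpNorm u (ENNReal.ofReal (2 * n / (n - 2))) (volume.restrict Ω) ^
          (2 * (n : ℝ) / (n - 2)) := hchebyshev
    _ ≤ (sobolevConst n * eLpNorm Du 2 (volume.restrict Ω)) ^ (2 * (n : ℝ) / (n - 2)) := by
        gcongr
        exact hu.eLpNorm_le_sobolevConst_mul hn
    _ = ((sobolevConst n : ENNReal) ^ 2 * ∫⁻ x in Ω, ‖Du x‖ₑ ^ 2) ^ ((n : ℝ) / (n - 2)) := by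
        rw [← hsq, ← mul_pow, ← ENNReal.rpow_natCast, ← ENNReal.rpow_mul, mul_div_assoc]
        norm_num

theorem WeakBound.restrict_lt_norm_le (hweak : WeakBound m Ω f γ)
    (hf : AEMeasurable f (volume.restrict Ω)) {t : ℝ} (ht : 0 < t) :
    volume.restrict Ω {x | t < ‖f x‖} ≤ ENNReal.ofReal (γ / t ^ m) := by
  rw [Measure.restrict_apply₀ (nullMeasurableSet_lt aemeasurable_const hf.norm)]
  refine (measure_mono ?_).trans (hweak t ht)
  exact fun x hx => ⟨hx.2, hx.1⟩

theorem WeakBound.lintegral_enorm_mul_le (hweak : WeakBound m Ω f γ)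
    (hf : AEMeasurable f (volume.restrict Ω)) (hm : 1 < m) (hγ : 0 < γ)
    {v : EuclideanSpace ℝ (Fin n) → ℝ} (hv : ∀ x, |v x| ≤ 1) {A : Set (EuclideanSpace ℝ (Fin n))}
    (hvA : ∀ x ∉ A, v x = 0) (hA : volume.restrict Ω A ≠ ⊤) :
    ∫⁻ x in Ω, ‖f x‖ₑ * ‖v x‖ₑ ≤ ENNReal.ofReal
      (m / (m - 1) * γ ^ (1 / m) * (volume.restrict Ω).real A ^ (1 - 1 / m)) := by
  set A' := toMeasurable (volume.restrict Ω) A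
  have hA' : (volume.restrict Ω).real A' = (volume.restrict Ω).real A := by
    rw [measureReal_def, measureReal_def, measure_toMeasurable]
  rw [← hA']
  refine le_trans ?_ (setLIntegral_enorm_le_of_measure_lt_norm_le hf.aestronglyMeasurable hm hγ
    (fun t ht => hweak.restrict_lt_norm_le hf ht) ((measure_toMeasurable A).trans_ne hA))
  rw [← lintegral_indicator (measurableSet_toMeasurable _ A)]
  refine lintegral_mono fun x => ?_
  by_cases hx : x ∈ A'
  · rw [Set.indicator_of_mem hx]
    refine mul_le_of_le_one_right zero_le ?_
    rw [← ofReal_norm, ENNReal.ofReal_le_one]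
    exact hv x
  · simp [hvA x fun h => hx (subset_toMeasurable _ _ h)]

/-- The constant in the decay of the level sets of `G(u)`, for an admissible profile `G` with
constant `K`: it does not depend on `θ`, on the domain or on the upper bound of the coefficient. -/
noncomputable def levelDecayConst (n : ℕ) (α K m γ : ℝ) : ℝ :=
  (sobolevConst n ^ 2 * (2 * transitionSlope * K / α * (m / (m - 1) * γ ^ (1 / m)))) ^
    ((n : ℝ) / (n - 2))

theorem levelDecayConst_nonneg {K : ℝ} (hα : 0 ≤ α) (hK : 0 ≤ K) (hm : 1 ≤ m) (hγ : 0 ≤ γ) :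
    0 ≤ levelDecayConst n α K m γ := by
  have := transitionSlope_nonneg
  have := sub_nonneg.2 hm
  unfold levelDecayConst
  positivity

theorem IsBoundedTestSolution.lintegral_enorm_sq_oddCutoff_le
    (hu : IsBoundedTestSolution Ω a f u Du) (hα : 0 < α) (hθ : 0 ≤ θ) (hΩ : volume Ω ≠ ⊤)
    (ha : IsCaratheodory Ω a) (hab : DegenerateBounds Ω α β θ a) (hm : 1 < m) (hγ : 0 < γ)
    (hf : AEMeasurable f (volume.restrict Ω)) (hweak : WeakBound m Ω f γ) {K : ℝ} {G : ℝ → ℝ}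
    (hG : IsAdmissibleProfile K θ G) {k δ : ℝ} (hk : 0 ≤ k) (hδ : 0 < δ) :
    ∫⁻ x in Ω, ‖deriv (fun s => oddCutoff k δ (G s)) (u x) • Du x‖ₑ ^ 2 ≤
      ENNReal.ofReal (2 * transitionSlope / δ * K / α *
        (m / (m - 1) * γ ^ (1 / m) *
          (volume.restrict Ω).real {x | k < |G (u x)|} ^ (1 - 1 / m))) := by
  have : IsFiniteMeasure (volume.restrict Ω) := isFiniteMeasure_restrict.2 hΩ
  have hΨ := hG.oddCutoff_comp hk hδ
  have henergy := hu.lintegral_enorm_sq_le hα hθ ha hab hΨ fun s => abs_oddCutoff_le_one k δ (G s)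
  have hright := hweak.lintegral_enorm_mul_le hf hm hγ
    (fun x => abs_oddCutoff_le_one k δ (G (u x)))
    (fun x (hx : x ∉ {x | k < |G (u x)|}) => oddCutoff_eq_zero hδ (not_lt.1 hx))
    (measure_ne_top _ _)
  rw [ENNReal.ofReal_mul (div_nonneg hΨ.nonneg hα.le)]
  exact henergy.trans (by gcongr)

theorem IsBoundedTestSolution.levelDecay (hu : IsBoundedTestSolution Ω a f u Du) (hn : 2 < n)
    (hα : 0 < α) (hθ : 0 ≤ θ) (hΩ : volume Ω ≠ ⊤) (ha : IsCaratheodory Ω a)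
    (hab : DegenerateBounds Ω α β θ a) (hm : 1 < m) (hγ : 0 < γ)
    (hf : AEMeasurable f (volume.restrict Ω)) (hweak : WeakBound m Ω f γ) {K : ℝ} {G : ℝ → ℝ}
    (hG : IsAdmissibleProfile K θ G) :
    LevelDecay (levelDecayConst n α K m γ) (n / (n - 2)) ((1 - 1 / m) * (n / (n - 2)))
      fun t => (volume.restrict Ω).real {x | t < |G (u x)|} := by
  have hn2 : (0 : ℝ) < n - 2 := sub_pos.2 (by exact_mod_cast hn)
  have : 0 < m - 1 := sub_pos.2 hm
  have hK := hG.nonneg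
  have hslope := transitionSlope_nonneg
  have : IsFiniteMeasure (volume.restrict Ω) := isFiniteMeasure_restrict.2 hΩ
  refine ⟨fun t => measureReal_nonneg, fun s t hst => measureReal_mono fun x hx => hst.trans_lt hx,
    fun k δ hk hδ => ?_⟩
  have hΨ := hG.oddCutoff_comp hk hδ
  have hv := hu.hasW012Gradient.comp hΨ.contDiff hΨ.map_zero (hΨ.abs_deriv_le hθ)
  have henergy := hu.lintegral_enorm_sq_oddCutoff_le hα hθ hΩ ha hab hm hγ hf hweak hG hk hδ
  set Ψ := fun s => oddCutoff k δ (G s)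
  set V := (volume.restrict Ω).real {x | k < |G (u x)|}
  have hV : 0 ≤ V := measureReal_nonneg
  refine ENNReal.toReal_le_of_le_ofReal (by unfold levelDecayConst; positivity) ?_
  calc volume.restrict Ω {x | k + δ < |G (u x)|}
      ≤ volume.restrict Ω {x | 1 ≤ |Ψ (u x)|} :=
        measure_mono fun x hx => (abs_oddCutoff_eq_one hk hδ (le_of_lt hx)).ge
    _ ≤ ((sobolevConst n : ENNReal) ^ 2 * ∫⁻ x in Ω, ‖deriv Ψ (u x) • Du x‖ₑ ^ 2) ^
          ((n : ℝ) / (n - 2)) := hv.measure_one_le_abs_le hn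
    _ ≤ (ENNReal.ofReal (sobolevConst n ^ 2) * ENNReal.ofReal (2 * transitionSlope / δ * K / α *
          (m / (m - 1) * γ ^ (1 / m) * V ^ (1 - 1 / m)))) ^ ((n : ℝ) / (n - 2)) := by
        rw [ENNReal.ofReal_pow NNReal.zero_le_coe, ENNReal.ofReal_coe_nnreal]
        gcongr
    _ = ENNReal.ofReal (levelDecayConst n α K m γ * δ ^ (-((n : ℝ) / (n - 2))) *
          V ^ ((1 - 1 / m) * ((n : ℝ) / (n - 2)))) := by
        rw [← ENNReal.ofReal_mul (by positivity),
          ENNReal.ofReal_rpow_of_nonneg (by positivity) (by positivity), levelDecayConst,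
          Real.rpow_neg hδ.le, ← Real.inv_rpow hδ.le, Real.rpow_mul hV,
          ← Real.mul_rpow (by positivity) (by positivity),
          ← Real.mul_rpow (by positivity) (by positivity)]
        ring_nf

end WeakSolution

section Profiles

variable {θ τ : ℝ}

theorem one_add_abs_le_two_mul_sqrt (s : ℝ) : 1 + |s| ≤ 2 * √(1 + s ^ 2) := by
  have h1 : 1 ≤ √(1 + s ^ 2) := Real.one_le_sqrt.2 (le_add_of_nonneg_right (sq_nonneg s))
  have h2 : |s| ≤ √(1 + s ^ 2) := Real.abs_le_sqrt (le_add_of_nonneg_left zero_le_one)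
  linarith

theorem log_exp_one_add_abs_le (s : ℝ) : Real.log (Real.exp 1 + |s|) ≤ 1 + |Real.arsinh s| := by
  have hs : |s| = Real.exp |Real.arsinh s| - Real.cosh |Real.arsinh s| := by
    rw [Real.exp_sub_cosh, ← Real.abs_sinh, Real.sinh_arsinh]
  rw [Real.log_le_iff_le_exp (by positivity), Real.exp_add, hs]
  nlinarith [Real.one_le_cosh |Real.arsinh s|, Real.one_le_exp (abs_nonneg (Real.arsinh s)),
    Real.one_le_exp zero_le_one]

theorem degeneracyWeight_le_mul_sqrt (hθ : θ ≤ 1) (s : ℝ) :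
    degeneracyWeight θ s ≤ 4 * (√(1 + Real.arsinh s ^ 2) * √(1 + s ^ 2)) := by
  have hlog := one_le_log_exp_one_add_abs s
  calc degeneracyWeight θ s ≤ (1 + |s|) * Real.log (Real.exp 1 + |s|) :=
        mul_le_mul (Real.rpow_le_self_of_one_le (le_add_of_nonneg_right (abs_nonneg s)) hθ)
          (Real.rpow_le_self_of_one_le hlog hθ) (Real.rpow_nonneg (by linarith) _) (by positivity)
    _ ≤ (2 * √(1 + s ^ 2)) * (2 * √(1 + Real.arsinh s ^ 2)) :=
        mul_le_mul (one_add_abs_le_two_mul_sqrt s)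
          ((log_exp_one_add_abs_le s).trans (one_add_abs_le_two_mul_sqrt _)) (by linarith)
          (by positivity)
    _ = 4 * (√(1 + Real.arsinh s ^ 2) * √(1 + s ^ 2)) := by ring

theorem hasDerivAt_arsinh_arsinh (s : ℝ) :
    HasDerivAt (fun s => Real.arsinh (Real.arsinh s))
      ((√(1 + Real.arsinh s ^ 2))⁻¹ * (√(1 + s ^ 2))⁻¹) s :=
  (Real.hasDerivAt_arsinh (Real.arsinh s)).comp s (Real.hasDerivAt_arsinh s)

theorem isAdmissibleProfile_arsinh_arsinh (hθ : θ ≤ 1) :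
    IsAdmissibleProfile 4 θ fun s => Real.arsinh (Real.arsinh s) where
  contDiff := Real.contDiff_arsinh.comp Real.contDiff_arsinh
  map_zero := by simp only [Real.arsinh_zero]
  deriv_nonneg s := by
    rw [(hasDerivAt_arsinh_arsinh s).deriv]
    positivity
  deriv_le s := by
    rw [(hasDerivAt_arsinh_arsinh s).deriv, le_div_iff₀ (degeneracyWeight_pos θ s), ← mul_inv,
      inv_mul_le_iff₀ (by positivity), mul_comm]
    exact degeneracyWeight_le_mul_sqrt hθ s

theorem abs_le_sinh_sinh {s d : ℝ} (h : |Real.arsinh (Real.arsinh s)| ≤ d) :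
    |s| ≤ Real.sinh (Real.sinh d) := by
  have hs : |s| = Real.sinh (Real.sinh |Real.arsinh (Real.arsinh s)|) := by
    rw [← Real.abs_sinh, ← Real.abs_sinh, Real.sinh_arsinh, Real.sinh_arsinh]
  rw [hs]
  exact Real.sinh_le_sinh.2 (Real.sinh_le_sinh.2 h)

theorem exists_degeneracyWeight_le (hθ : 0 ≤ θ) (hτ : θ < τ) :
    ∃ K : ℝ, ∀ s : ℝ, degeneracyWeight θ s ≤ K * (1 + s ^ 2) ^ (τ / 2) := by
  set ε := (τ - θ) / (θ + 1) with hε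
  have hε0 : 0 < ε := div_pos (by linarith) (by linarith)
  have hexponent : θ + ε * θ ≤ τ := by
    have : ε * (θ + 1) = τ - θ := by
      rw [hε]
      field_simp
    linarith
  refine ⟨(1 / ε) ^ θ * (2 * Real.exp 1) ^ τ, fun s => ?_⟩
  have he : 1 ≤ Real.exp 1 := Real.one_le_exp zero_le_one
  have hx : 1 ≤ Real.exp 1 + |s| := by linarith [abs_nonneg s]
  have hlog : Real.log (Real.exp 1 + |s|) ≤ 1 / ε * (Real.exp 1 + |s|) ^ ε := by
    rw [one_div_mul_eq_div]
    exact Real.log_le_rpow_div (by linarith) hε0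
  have hsqrt : Real.exp 1 + |s| ≤ 2 * Real.exp 1 * (1 + s ^ 2) ^ (1 / 2 : ℝ) := by
    rw [← Real.sqrt_eq_rpow]
    nlinarith [one_add_abs_le_two_mul_sqrt s, abs_nonneg s]
  calc degeneracyWeight θ s
      ≤ (Real.exp 1 + |s|) ^ θ * (1 / ε * (Real.exp 1 + |s|) ^ ε) ^ θ := by
        have := one_le_log_exp_one_add_abs s
        unfold degeneracyWeight
        gcongr
    _ = (1 / ε) ^ θ * (Real.exp 1 + |s|) ^ (θ + ε * θ) := by
        rw [Real.mul_rpow (by positivity) (by positivity), ← Real.rpow_mul (by positivity),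
          Real.rpow_add (by positivity)]
        ring
    _ ≤ (1 / ε) ^ θ * (2 * Real.exp 1 * (1 + s ^ 2) ^ (1 / 2 : ℝ)) ^ τ := by
        have : 0 ≤ τ := by linarith
        gcongr ?_ * ?_
        exact (Real.rpow_le_rpow_of_exponent_le hx hexponent).trans (by gcongr)
    _ = (1 / ε) ^ θ * (2 * Real.exp 1) ^ τ * (1 + s ^ 2) ^ (τ / 2) := by
        rw [Real.mul_rpow (by positivity) (by positivity), ← Real.rpow_mul (by positivity),
          mul_assoc, one_div_mul_eq_div 2 τ]

/-- A smooth odd function growing like `|s|^{1 - τ}`. -/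
noncomputable def powerProfile (τ s : ℝ) : ℝ := s * (1 + s ^ 2) ^ (-(τ / 2))

theorem hasDerivAt_powerProfile (τ s : ℝ) :
    HasDerivAt (powerProfile τ)
      ((1 + s ^ 2) ^ (-(τ / 2)) * (1 - τ * (s ^ 2 / (1 + s ^ 2)))) s := by
  have hpos : 0 < 1 + s ^ 2 := by positivity
  have hinner : HasDerivAt (fun s : ℝ => 1 + s ^ 2) (2 * s) s := by
    simpa using (hasDerivAt_pow 2 s).const_add 1
  refine ((hasDerivAt_id s).mul
    (hinner.rpow_const (p := -(τ / 2)) (Or.inl hpos.ne'))).congr_deriv ?_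
  rw [Real.rpow_sub_one hpos.ne', id_eq]
  field_simp
  ring

theorem exists_isAdmissibleProfile_powerProfile (hθ : 0 ≤ θ) (hτ : θ < τ) (hτ1 : τ ≤ 1) :
    ∃ K, IsAdmissibleProfile K θ (powerProfile τ) := by
  obtain ⟨K, hK⟩ := exists_degeneracyWeight_le hθ hτ
  have hpos (s : ℝ) : 0 < 1 + s ^ 2 := by positivity
  have hpow (s : ℝ) : 0 ≤ (1 + s ^ 2) ^ (-(τ / 2)) := Real.rpow_nonneg (hpos s).le _
  have hfrac_nonneg (s : ℝ) : 0 ≤ s ^ 2 / (1 + s ^ 2) := by positivity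
  have hfrac_le (s : ℝ) : s ^ 2 / (1 + s ^ 2) ≤ 1 :=
    (div_le_one (hpos s)).2 (le_add_of_nonneg_left zero_le_one)
  refine ⟨K, ?_, zero_mul _, fun s => ?_, fun s => ?_⟩
  · exact contDiff_id.mul ((contDiff_const.add (contDiff_id.pow 2)).rpow_const_of_ne
      fun s => (hpos s).ne')
  · rw [(hasDerivAt_powerProfile τ s).deriv]
    exact mul_nonneg (hpow s) (sub_nonneg.2 (mul_le_one₀ hτ1 (hfrac_nonneg s) (hfrac_le s)))
  · rw [(hasDerivAt_powerProfile τ s).deriv, le_div_iff₀ (degeneracyWeight_pos θ s)]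
    have hderiv_le : (1 + s ^ 2) ^ (-(τ / 2)) * (1 - τ * (s ^ 2 / (1 + s ^ 2))) ≤
        (1 + s ^ 2) ^ (-(τ / 2)) :=
      mul_le_of_le_one_right (hpow s)
        (sub_le_self _ (mul_nonneg (hθ.trans hτ.le) (hfrac_nonneg s)))
    calc _ ≤ (1 + s ^ 2) ^ (-(τ / 2)) * (K * (1 + s ^ 2) ^ (τ / 2)) :=
          mul_le_mul hderiv_le (hK s) (degeneracyWeight_pos θ s).le (hpow s)
      _ = K := by rw [mul_left_comm, ← Real.rpow_add (hpos s), neg_add_cancel, Real.rpow_zero,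
          mul_one]

theorem abs_rpow_le_one_add_abs_powerProfile (hτ0 : 0 ≤ τ) (hτ1 : τ ≤ 1) (s : ℝ) :
    |s| ^ (1 - τ) ≤ 1 + |powerProfile τ s| := by
  have hpos : 0 < 1 + s ^ 2 := by positivity
  have hpow : 0 ≤ (1 + s ^ 2) ^ (-(τ / 2)) := by positivity
  have hpow_le : (1 + s ^ 2) ^ (-(τ / 2)) ≤ 1 :=
    Real.rpow_le_one_of_one_le_of_nonpos (le_add_of_nonneg_right (sq_nonneg s)) (by linarith)
  have habs : |s| ≤ √(1 + s ^ 2) := Real.abs_le_sqrt (le_add_of_nonneg_left zero_le_one)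
  have hsqrt : √(1 + s ^ 2) ≤ 1 + |s| := Real.sqrt_le_iff.2
    ⟨by positivity, by nlinarith [sq_abs s, abs_nonneg s]⟩
  calc |s| ^ (1 - τ) ≤ √(1 + s ^ 2) ^ (1 - τ) :=
        Real.rpow_le_rpow (abs_nonneg s) habs (sub_nonneg.2 hτ1)
    _ = √(1 + s ^ 2) * (1 + s ^ 2) ^ (-(τ / 2)) := by
        rw [Real.sqrt_eq_rpow, ← Real.rpow_mul hpos.le, ← Real.rpow_add hpos]
        ring_nf
    _ ≤ (1 + |s|) * (1 + s ^ 2) ^ (-(τ / 2)) := by gcongr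
    _ ≤ 1 + |powerProfile τ s| := by
        rw [powerProfile, abs_mul, abs_of_nonneg hpow, add_mul, one_mul]
        gcongr

end Profiles

section WeakSpaces

variable {n : ℕ} {Ω : Set (EuclideanSpace ℝ (Fin n))} {m p q γ γ' : ℝ}
  {f h w : EuclideanSpace ℝ (Fin n) → ℝ}

theorem WeakBound.mono (hweak : WeakBound m Ω f γ) (hγ : γ ≤ γ') : WeakBound m Ω f γ' :=
  fun t ht => (hweak t ht).trans (ENNReal.ofReal_le_ofReal (by gcongr))

theorem MemWeakL.exists_pos_weakBound (hf : MemWeakL m Ω f) : ∃ γ, 0 < γ ∧ WeakBound m Ω f γ := by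
  obtain ⟨γ, hγ⟩ := hf.2
  exact ⟨max γ 1, lt_max_of_lt_right one_pos, hγ.mono (le_max_left γ 1)⟩

theorem sInf_weakBound_nonneg (m : ℝ) (Ω : Set (EuclideanSpace ℝ (Fin n)))
    (f : EuclideanSpace ℝ (Fin n) → ℝ) : 0 ≤ sInf {γ : ℝ | 0 < γ ∧ WeakBound m Ω f γ} :=
  Real.sInf_nonneg fun _ hγ => hγ.1.le

theorem weakNorm_nonneg (m : ℝ) (Ω : Set (EuclideanSpace ℝ (Fin n)))
    (f : EuclideanSpace ℝ (Fin n) → ℝ) : 0 ≤ weakNorm m Ω f :=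
  Real.rpow_nonneg (sInf_weakBound_nonneg m Ω f) _

theorem MemWeakL.weakBound_of_weakNorm_rpow_lt (hf : MemWeakL m Ω f) (hm : 0 < m)
    (hγ : weakNorm m Ω f ^ m < γ) : WeakBound m Ω f γ := by
  rw [weakNorm, ← Real.rpow_mul (sInf_weakBound_nonneg m Ω f), one_div_mul_cancel hm.ne',
    Real.rpow_one] at hγ
  obtain ⟨γ', hγ', hlt⟩ := exists_lt_of_csInf_lt hf.exists_pos_weakBound hγ
  exact hγ'.2.mono hlt.le

theorem weakBound_of_measureReal_lt_abs_le (hΩ : volume Ω ≠ ⊤)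
    (htail : ∀ t, 0 < t → (volume.restrict Ω).real {x | t < |w x|} ≤ γ / t ^ q) :
    WeakBound q Ω w γ := by
  have : IsFiniteMeasure (volume.restrict Ω) := isFiniteMeasure_restrict.2 hΩ
  intro t ht
  calc volume {x | x ∈ Ω ∧ t < |w x|} ≤ volume ({x | t < |w x|} ∩ Ω) :=
        measure_mono fun x hx => ⟨hx.2, hx.1⟩
    _ ≤ volume.restrict Ω {x | t < |w x|} := Measure.le_restrict_apply _ _
    _ = ENNReal.ofReal ((volume.restrict Ω).real {x | t < |w x|}) := by rw [ofReal_measureReal]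
    _ ≤ ENNReal.ofReal (γ / t ^ q) := ENNReal.ofReal_le_ofReal (htail t ht)

theorem WeakBound.one_add_abs (hw : WeakBound q Ω w γ) (hΩ : volume Ω ≠ ⊤) (hq : 0 ≤ q) :
    WeakBound q Ω (fun x => 1 + |w x|) ((volume.real Ω + max γ 0) * 2 ^ q) := by
  intro t ht
  have hV : 0 ≤ volume.real Ω := measureReal_nonneg
  have hγ : 0 ≤ max γ 0 := le_max_right _ _
  have habs (x) : |(1 + |w x| : ℝ)| = 1 + |w x| := abs_of_nonneg (by positivity)
  simp only [habs]
  rw [mul_div_assoc, ← Real.div_rpow two_pos.le ht.le]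
  rcases le_or_gt t 2 with ht2 | ht2
  · calc volume {x | x ∈ Ω ∧ t < 1 + |w x|} ≤ volume Ω := measure_mono fun x hx => hx.1
      _ = ENNReal.ofReal (volume.real Ω) := (ofReal_measureReal hΩ).symm
      _ ≤ _ := by
        refine ENNReal.ofReal_le_ofReal ?_
        have := Real.one_le_rpow ((one_le_div ht).2 ht2) hq
        nlinarith
  · calc volume {x | x ∈ Ω ∧ t < 1 + |w x|} ≤ volume {x | x ∈ Ω ∧ t / 2 < |w x|} :=
          measure_mono fun x hx => ⟨hx.1, by linarith [hx.2]⟩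
      _ ≤ ENNReal.ofReal (γ / (t / 2) ^ q) := hw _ (by positivity)
      _ ≤ _ := by
        rw [div_eq_mul_inv γ, ← Real.inv_rpow (by positivity), inv_div]
        gcongr
        exact (le_max_left _ _).trans (le_add_of_nonneg_left hV)

theorem WeakBound.memWeakL_of_abs_le (hw : WeakBound q Ω w γ) (hp : 0 < p) {C : ℝ} (hC : 0 < C)
    (hh : AEMeasurable h (volume.restrict Ω)) (hle : ∀ x, |h x| ≤ C * |w x| ^ p) :
    MemWeakL (q / p) Ω h := by
  refine ⟨hh, γ * C ^ (q / p), fun t ht => ?_⟩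
  have hlevel : {x | x ∈ Ω ∧ t < |h x|} ⊆ {x | x ∈ Ω ∧ (t / C) ^ (1 / p) < |w x|} := by
    refine fun x hx => ⟨hx.1, ?_⟩
    have hlt : t / C < |w x| ^ p := (div_lt_iff₀' hC).2 (hx.2.trans_le (hle x))
    simpa only [one_div, Real.rpow_rpow_inv (abs_nonneg (w x)) hp.ne'] using
      Real.rpow_lt_rpow (div_pos ht hC).le hlt (one_div_pos.2 hp)
  refine (measure_mono hlevel).trans ((hw _ (by positivity)).trans_eq ?_)
  rw [← Real.rpow_mul (by positivity), one_div_mul_eq_div, Real.div_rpow ht.le hC.le,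
    div_div_eq_mul_div]

end WeakSpaces

section ExponentialIntegrability

variable {X E : Type*} [MeasurableSpace X] {ν : Measure X} [IsFiniteMeasure ν]
  [NormedAddCommGroup E]

theorem integrable_of_measure_lt_norm_le {f : X → E} (hf : AEStronglyMeasurable f ν) {m γ : ℝ}
    (hm : 1 < m) (hγ : 0 < γ)
    (hweak : ∀ t : ℝ, 0 < t → ν {x | t < ‖f x‖} ≤ ENNReal.ofReal (γ / t ^ m)) :
    Integrable f ν := by
  have h := setLIntegral_enorm_le_of_measure_lt_norm_le hf hm hγ hweak (measure_ne_top ν Set.univ)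
  rw [Measure.restrict_univ] at h
  exact ⟨hf, h.trans_lt ENNReal.ofReal_lt_top⟩

theorem integrable_exp_mul_of_tail_le {w : X → ℝ} (hw : AEMeasurable w ν) {C τ η : ℝ}
    (hτ : 0 < τ) (hη : 0 < η) (hητ : η * τ < 1)
    (htail : ∀ t, 0 ≤ t → ν.real {x | t < w x} ≤ C * Real.exp (-(t / τ))) :
    Integrable (fun x => Real.exp (η * w x)) ν := by
  have hC : 0 ≤ C := by simpa using measureReal_nonneg.trans (htail 0 le_rfl)
  have hV : 0 ≤ ν.real Set.univ := measureReal_nonneg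
  refine integrable_of_measure_lt_norm_le (m := 1 / (η * τ)) (γ := C + ν.real Set.univ + 1)
    (hw.const_mul η).exp.aestronglyMeasurable ((one_lt_div (by positivity)).2 hητ)
    (by positivity) fun s hs => ?_
  have hs' : 0 < s ^ (1 / (η * τ)) := Real.rpow_pos_of_pos hs _
  simp only [Real.norm_eq_abs, Real.abs_exp]
  rw [← ofReal_measureReal]
  refine ENNReal.ofReal_le_ofReal ((le_div_iff₀ hs').2 ?_)
  rcases le_total s 1 with hs1 | hs1
  · calc ν.real {x | s < Real.exp (η * w x)} * s ^ (1 / (η * τ)) ≤ ν.real Set.univ * 1 := by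
          gcongr
          · exact measure_ne_top _ _
          · exact Set.subset_univ _
          · exact Real.rpow_le_one hs.le hs1 (by positivity)
      _ ≤ _ := by linarith
  · have hlevel : {x | s < Real.exp (η * w x)} = {x | Real.log s / η < w x} := by
      ext x
      rw [Set.mem_ofPred_eq, Set.mem_ofPred_eq, div_lt_iff₀' hη, Real.log_lt_iff_lt_exp hs]
    calc ν.real {x | s < Real.exp (η * w x)} * s ^ (1 / (η * τ))
        ≤ C * Real.exp (-(Real.log s / η / τ)) * s ^ (1 / (η * τ)) := by
          rw [hlevel]
          gcongr
          exact htail _ (div_nonneg (Real.log_nonneg hs1) hη.le)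
      _ = C := by
          rw [Real.rpow_def_of_pos hs, mul_assoc, ← Real.exp_add, div_div, mul_one_div,
            neg_add_cancel, Real.exp_zero, mul_one]
      _ ≤ _ := by linarith

end ExponentialIntegrability

section Growth

theorem exists_mul_rpow_le_add_mul_rpow (l : ℝ) {ρ σ η : ℝ} (hρ : 0 < ρ) (hρσ : ρ < σ)
    (hη : 0 < η) : ∃ C, ∀ x, 0 ≤ x → l * x ^ ρ ≤ C + η * x ^ σ := by
  have hσρ : 0 < σ - ρ := sub_pos.2 hρσ
  -- Beyond `y` the power `x ^ σ` dominates.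
  set y := (|l| / η) ^ (1 / (σ - ρ)) with hy
  have : 0 ≤ y := by positivity
  refine ⟨|l| * y ^ ρ, fun x hx => (mul_le_mul_of_nonneg_right (le_abs_self l)
    (Real.rpow_nonneg hx ρ)).trans ?_⟩
  rcases le_total x y with hxy | hxy
  · have : |l| * x ^ ρ ≤ |l| * y ^ ρ := by gcongr
    exact this.trans (le_add_of_nonneg_right (by positivity))
  · have hl : |l| / η ≤ x ^ (σ - ρ) := by
      calc |l| / η = y ^ (σ - ρ) := by
            rw [hy, ← Real.rpow_mul (by positivity), one_div_mul_cancel hσρ.ne', Real.rpow_one]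
        _ ≤ x ^ (σ - ρ) := by gcongr
    have hmain : |l| * x ^ ρ ≤ η * x ^ σ := by
      calc |l| * x ^ ρ ≤ η * x ^ (σ - ρ) * x ^ ρ := by
            gcongr
            exact (div_le_iff₀' hη).1 hl
        _ = η * x ^ σ := by
            rw [mul_assoc, ← Real.rpow_add' hx (by linarith), sub_add_cancel]
    exact hmain.trans (le_add_of_nonneg_left (by positivity))

theorem mul_log_exp_one_add_le {σ p : ℝ} (hσ0 : 0 < σ) (hσ1 : σ ≤ 1) (hpσ : 1 < p * σ) {x : ℝ}
    (hx : 0 ≤ x) :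
    x * Real.log (Real.exp 1 + x) ≤ Real.exp p / (p * σ - 1) * (1 + x ^ σ) ^ p := by
  have hp : 0 < p := pos_of_mul_pos_left (one_pos.trans hpσ) hσ0.le
  have hε : 0 < p * σ - 1 := sub_pos.2 hpσ
  have hy : 0 < Real.exp 1 + x := by positivity
  have hbase : (Real.exp 1 + x) ^ σ ≤ Real.exp 1 * (1 + x ^ σ) :=
    calc (Real.exp 1 + x) ^ σ ≤ Real.exp 1 ^ σ + x ^ σ :=
          Real.rpow_add_le_add_rpow (Real.exp_pos 1).le hx hσ0.le hσ1
      _ ≤ Real.exp 1 * 1 + Real.exp 1 * x ^ σ := by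
          rw [Real.exp_one_rpow, mul_one]
          exact add_le_add (Real.exp_le_exp.2 hσ1)
            (le_mul_of_one_le_left (by positivity) (Real.one_le_exp zero_le_one))
      _ = Real.exp 1 * (1 + x ^ σ) := by ring
  calc x * Real.log (Real.exp 1 + x)
      ≤ (Real.exp 1 + x) * ((Real.exp 1 + x) ^ (p * σ - 1) / (p * σ - 1)) :=
        mul_le_mul (le_add_of_nonneg_left (Real.exp_pos 1).le)
          (Real.log_le_rpow_div hy.le hε)
          (Real.log_nonneg (by linarith [Real.add_one_le_exp 1])) hy.le
    _ = ((Real.exp 1 + x) ^ σ) ^ p / (p * σ - 1) := by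
        rw [← Real.rpow_mul hy.le, mul_comm σ p, Real.rpow_sub_one hy.ne']
        field_simp
    _ ≤ (Real.exp 1 * (1 + x ^ σ)) ^ p / (p * σ - 1) := by gcongr
    _ = Real.exp p / (p * σ - 1) * (1 + x ^ σ) ^ p := by
        rw [Real.mul_rpow (Real.exp_pos 1).le (by positivity), Real.exp_one_rpow]
        ring

end Growth

section Regularity

variable {n : ℕ} {Ω : Set (EuclideanSpace ℝ (Fin n))} {α β θ m : ℝ}
  {a : EuclideanSpace ℝ (Fin n) → ℝ → ℝ} {f u : EuclideanSpace ℝ (Fin n) → ℝ}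
  {Du : EuclideanSpace ℝ (Fin n) → EuclideanSpace ℝ (Fin n)}

theorem exists_ae_abs_le_of_half_dim_lt (hn : 2 < n) (hα : 0 < α) (hm : (n : ℝ) / 2 < m)
    (N V : ℝ) : ∃ L : ℝ, 0 < L ∧ ∀ θ, 0 ≤ θ → θ ≤ 1 →
      ∀ Ω : Set (EuclideanSpace ℝ (Fin n)), volume Ω ≠ ⊤ → volume.real Ω ≤ V →
      ∀ β a, IsCaratheodory Ω a → DegenerateBounds Ω α β θ a →
      ∀ f, MemWeakL m Ω f → weakNorm m Ω f ≤ N →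
      ∀ u Du, IsBoundedTestSolution Ω a f u Du → ∀ᵐ x ∂(volume.restrict Ω), |u x| ≤ L := by
  have hn' : (2 : ℝ) < n := by exact_mod_cast hn
  have hn2 : (0 : ℝ) < n - 2 := sub_pos.2 hn'
  have hm1 : 1 < m := by linarith
  have hb : 1 < (1 - 1 / m) * ((n : ℝ) / (n - 2)) := by
    have hnm : (n : ℝ) / m < 2 := by rw [div_lt_iff₀ (by linarith)]; linarith
    rw [← mul_div_assoc, one_lt_div hn2, sub_mul, one_mul, one_div_mul_eq_div]
    linarith
  obtain ⟨d, hd, hvanish⟩ := LevelDecay.exists_forall_eq_zero (a := (n : ℝ) / (n - 2))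
    (levelDecayConst_nonneg (n := n) (K := 4) (γ := |N| ^ m + 1) hα.le zero_le_four hm1.le
      (by positivity)) (by positivity) hb V
  refine ⟨Real.sinh (Real.sinh d), Real.sinh_pos_iff.2 (Real.sinh_pos_iff.2 hd), ?_⟩
  intro θ hθ hθ1 Ω hΩ hV β a ha hab f hf hN u Du hu
  have : IsFiniteMeasure (volume.restrict Ω) := isFiniteMeasure_restrict.2 hΩ
  have hweak : WeakBound m Ω f (|N| ^ m + 1) := by
    refine hf.weakBound_of_weakNorm_rpow_lt (by linarith) (lt_add_of_le_of_pos ?_ one_pos)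
    exact Real.rpow_le_rpow (weakNorm_nonneg m Ω f) (hN.trans (le_abs_self N)) (by linarith)
  have hdecay := hu.levelDecay hn hα hθ hΩ ha hab hm1 (by positivity) hf.1 hweak
    (isAdmissibleProfile_arsinh_arsinh hθ1)
  have hzero := hvanish _ hdecay
    ((measureReal_mono (Set.subset_univ _)).trans (by simpa using hV))
  filter_upwards [measure_eq_zero_iff_ae_notMem.1 ((measureReal_eq_zero_iff).1 hzero)] with x hx
  exact abs_le_sinh_sinh (not_lt.1 hx)

theorem IsBoundedTestSolution.exists_integrable_exp_mul_abs_powerProfile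
    (hu : IsBoundedTestSolution Ω a f u Du) (hn : 2 < n) (hα : 0 < α) (hθ : 0 ≤ θ)
    (hΩ : volume Ω ≠ ⊤) (ha : IsCaratheodory Ω a) (hab : DegenerateBounds Ω α β θ a)
    (hf : MemWeakL (n / 2) Ω f) {τ : ℝ} (hτ : θ < τ) (hτ1 : τ ≤ 1) :
    ∃ η, 0 < η ∧ IntegrableOn (fun x => Real.exp (η * |powerProfile τ (u x)|)) Ω := by
  have hn' : (2 : ℝ) < n := by exact_mod_cast hn
  have hn2 : (0 : ℝ) < n - 2 := sub_pos.2 hn'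
  have : IsFiniteMeasure (volume.restrict Ω) := isFiniteMeasure_restrict.2 hΩ
  obtain ⟨K, hG⟩ := exists_isAdmissibleProfile_powerProfile hθ hτ hτ1
  obtain ⟨γ, hγ, hweak⟩ := hf.exists_pos_weakBound
  have hdecay := hu.levelDecay hn hα hθ hΩ ha hab ((one_lt_div two_pos).2 hn') hγ hf.1 hweak hG
  have hb : (1 - 1 / ((n : ℝ) / 2)) * ((n : ℝ) / (n - 2)) = 1 := by field_simp
  rw [hb] at hdecay
  obtain ⟨T, hT, hexp⟩ := hdecay.exists_le_exp (by positivity)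
  refine ⟨1 / (2 * T), by positivity, integrable_exp_mul_of_tail_le
    (hG.contDiff.continuous.measurable.comp_aemeasurable hu.hasW012Gradient.aemeasurable).abs hT
    (by positivity) (by field_simp; norm_num)
    (C := (volume.restrict Ω).real {x | 0 < |powerProfile τ (u x)|} * Real.exp 1)
    fun t ht => (hexp t ht).trans_eq ?_⟩
  rw [sub_eq_add_neg, Real.exp_add, ← mul_assoc]

theorem IsBoundedTestSolution.integrableOn_exp_mul_rpow (hu : IsBoundedTestSolution Ω a f u Du)
    (hn : 2 < n) (hα : 0 < α) (hθ : 0 ≤ θ) (hΩ : volume Ω ≠ ⊤) (ha : IsCaratheodory Ω a)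
    (hab : DegenerateBounds Ω α β θ a) (hf : MemWeakL (n / 2) Ω f) {ρ : ℝ} (hρ : 0 < ρ)
    (hρθ : ρ < 1 - θ) (l : ℝ) : IntegrableOn (fun x => Real.exp (l * |u x| ^ ρ)) Ω := by
  obtain ⟨τ, hτ, hτρ⟩ := exists_between (lt_sub_comm.1 hρθ)
  have hτ1 : τ ≤ 1 := by linarith
  obtain ⟨η, hη, hint⟩ :=
    hu.exists_integrable_exp_mul_abs_powerProfile hn hα hθ hΩ ha hab hf hτ hτ1
  obtain ⟨C, hC⟩ := exists_mul_rpow_le_add_mul_rpow l hρ (lt_sub_comm.1 hτρ) hη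
  refine (hint.const_mul (Real.exp (C + η))).mono'
    ((hu.hasW012Gradient.aemeasurable.abs.pow_const ρ).const_mul l).exp.aestronglyMeasurable
    (Eventually.of_forall fun x => ?_)
  rw [Real.norm_eq_abs, Real.abs_exp, ← Real.exp_add, Real.exp_le_exp]
  calc l * |u x| ^ ρ ≤ C + η * |u x| ^ (1 - τ) := hC _ (abs_nonneg _)
    _ ≤ C + η * (1 + |powerProfile τ (u x)|) := by
        gcongr
        exact abs_rpow_le_one_add_abs_powerProfile (hθ.trans hτ.le) hτ1 (u x)
    _ = C + η + η * |powerProfile τ (u x)| := by ring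

theorem IsBoundedTestSolution.exists_weakBound_powerProfile
    (hu : IsBoundedTestSolution Ω a f u Du)
    (hn : 2 < n) (hα : 0 < α) (hθ : 0 ≤ θ) (hΩ : volume Ω ≠ ⊤) (ha : IsCaratheodory Ω a)
    (hab : DegenerateBounds Ω α β θ a) (hm : 1 < m) (hmn : m < (n : ℝ) / 2)
    (hf : MemWeakL m Ω f) {τ : ℝ} (hτ : θ < τ) (hτ1 : τ ≤ 1) :
    ∃ γ, WeakBound (n * m / (n - 2 * m)) Ω (fun x => powerProfile τ (u x)) γ := by
  have hn2 : (0 : ℝ) < n - 2 := by linarith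
  have hnm : (0 : ℝ) < n - 2 * m := by linarith
  have hm0 : 0 < m := by linarith
  obtain ⟨K, hG⟩ := exists_isAdmissibleProfile_powerProfile hθ hτ hτ1
  obtain ⟨γ, hγ, hweak⟩ := hf.exists_pos_weakBound
  have hdecay := hu.levelDecay hn hα hθ hΩ ha hab hm hγ hf.1 hweak hG
  have hb0 : 0 ≤ (1 - 1 / m) * ((n : ℝ) / (n - 2)) :=
    mul_nonneg (sub_nonneg.2 ((div_le_one hm0).2 hm.le)) (by positivity)
  have hb : 1 - (1 - 1 / m) * ((n : ℝ) / (n - 2)) = (n - 2 * m) / (m * (n - 2)) := by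
    field_simp
    ring
  have hb1 : (1 - 1 / m) * ((n : ℝ) / (n - 2)) < 1 := by
    rw [← sub_pos, hb]
    positivity
  have hq : (n : ℝ) / (n - 2) / (1 - (1 - 1 / m) * ((n : ℝ) / (n - 2))) =
      n * m / (n - 2 * m) := by
    rw [hb]
    field_simp
  obtain ⟨C, hC⟩ := hdecay.exists_le_rpow
    (levelDecayConst_nonneg hα.le hG.nonneg hm.le hγ.le) (by positivity) hb0 hb1
  rw [hq] at hC
  exact ⟨C, weakBound_of_measureReal_lt_abs_le hΩ hC⟩

theorem IsBoundedTestSolution.memWeakL_mul_log (hu : IsBoundedTestSolution Ω a f u Du)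
    (hn : 2 < n) (hα : 0 < α) (hθ : 0 ≤ θ) (hΩ : volume Ω ≠ ⊤) (ha : IsCaratheodory Ω a)
    (hab : DegenerateBounds Ω α β θ a) (hm : 1 < m) (hmn : m < (n : ℝ) / 2)
    (hf : MemWeakL m Ω f) {r : ℝ} (hr : 0 < r) (hrθ : r < n * m / (n - 2 * m) * (1 - θ)) :
    MemWeakL r Ω (fun x => |u x| * Real.log (Real.exp 1 + |u x|)) := by
  have hnm : (0 : ℝ) < n - 2 * m := by linarith
  set q := (n : ℝ) * m / (n - 2 * m)
  have hq : 0 < q := by positivity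
  obtain ⟨τ, hτ, hτr⟩ := exists_between (lt_sub_comm.1 ((div_lt_iff₀' hq).2 hrθ))
  have hrq : 0 < r / q := by positivity
  have hτ1 : τ ≤ 1 := by linarith
  obtain ⟨γ, hweak⟩ := hu.exists_weakBound_powerProfile hn hα hθ hΩ ha hab hm hmn hf hτ hτ1
  have hexponent : 1 < q / r * (1 - τ) := by
    rw [← inv_div, inv_mul_eq_div, one_lt_div hrq]
    linarith
  have : 0 < q / r * (1 - τ) - 1 := sub_pos.2 hexponent
  have hum := hu.hasW012Gradient.aemeasurable.abs
  rw [show r = q / (q / r) by field_simp]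
  refine (hweak.one_add_abs hΩ hq.le).memWeakL_of_abs_le (p := q / r)
    (C := Real.exp (q / r) / (q / r * (1 - τ) - 1) * 2 ^ (q / r)) (by positivity)
    (by positivity) (hum.mul (hum.const_add _).log) fun x => ?_
  calc |(|u x| * Real.log (Real.exp 1 + |u x|))| = |u x| * Real.log (Real.exp 1 + |u x|) :=
        abs_of_nonneg (mul_nonneg (abs_nonneg _)
          (zero_le_one.trans (one_le_log_exp_one_add_abs (u x))))
    _ ≤ Real.exp (q / r) / (q / r * (1 - τ) - 1) * (1 + |u x| ^ (1 - τ)) ^ (q / r) :=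
        mul_log_exp_one_add_le (by linarith) (by linarith) hexponent (abs_nonneg _)
    _ ≤ Real.exp (q / r) / (q / r * (1 - τ) - 1) *
          (2 * |(1 + |powerProfile τ (u x)|)|) ^ (q / r) := by
        gcongr
        have := abs_rpow_le_one_add_abs_powerProfile (hθ.trans hτ.le) hτ1 (u x)
        linarith [le_abs_self (1 + |powerProfile τ (u x)|), abs_nonneg (powerProfile τ (u x))]
    _ = Real.exp (q / r) / (q / r * (1 - τ) - 1) * 2 ^ (q / r) *
          |(1 + |powerProfile τ (u x)|)| ^ (q / r) := by
        rw [Real.mul_rpow two_pos.le (abs_nonneg _), mul_assoc]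

end Regularity

end DegenerateElliptic

open DegenerateElliptic in
theorem mainTheorem4_general (n : ℕ) (hn : 2 < n) (α : ℝ) (hα : 0 < α) (m : ℝ) :
    ((n : ℝ) / 2 < m → ∀ N V : ℝ, ∃ L : ℝ, 0 < L ∧ ∀ θ : ℝ, 0 ≤ θ → θ ≤ 1 →
      ∀ Ω : Set (EuclideanSpace ℝ (Fin n)), volume Ω ≠ ⊤ → volume.real Ω ≤ V →
      ∀ β a, IsCaratheodory Ω a → DegenerateBounds Ω α β θ a →
      ∀ f, MemWeakL m Ω f → weakNorm m Ω f ≤ N →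
      ∀ u Du, IsBoundedTestSolution Ω a f u Du → ∀ᵐ x ∂(volume.restrict Ω), |u x| ≤ L) ∧
    (m = (n : ℝ) / 2 → ∀ θ : ℝ, 0 ≤ θ → ∀ ρ : ℝ, 0 < ρ → ρ < 1 - θ → ∀ l : ℝ,
      ∀ Ω : Set (EuclideanSpace ℝ (Fin n)), volume Ω ≠ ⊤ →
      ∀ β a, IsCaratheodory Ω a → DegenerateBounds Ω α β θ a → ∀ f, MemWeakL m Ω f →
      ∀ u Du, IsBoundedTestSolution Ω a f u Du →
        IntegrableOn (fun x => Real.exp (l * |u x| ^ ρ)) Ω volume) ∧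
    (1 < m → m < (n : ℝ) / 2 → ∀ θ : ℝ, 0 ≤ θ →
      ∀ r : ℝ, 0 < r → r < (n : ℝ) * m / ((n : ℝ) - 2 * m) * (1 - θ) →
      ∀ Ω : Set (EuclideanSpace ℝ (Fin n)), volume Ω ≠ ⊤ →
      ∀ β a, IsCaratheodory Ω a → DegenerateBounds Ω α β θ a → ∀ f, MemWeakL m Ω f →
      ∀ u Du, IsBoundedTestSolution Ω a f u Du →
        MemWeakL r Ω (fun x => |u x| * Real.log (Real.exp 1 + |u x|))) := by
  refine ⟨exists_ae_abs_le_of_half_dim_lt hn hα, ?_, ?_⟩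
  · rintro rfl θ hθ ρ hρ hρθ l Ω hΩ β a ha hab f hf u Du hu
    exact hu.integrableOn_exp_mul_rpow hn hα hθ hΩ ha hab hf hρ hρθ l
  · intro hm hmn θ hθ r hr hrθ Ω hΩ β a ha hab f hf u Du hu
    exact hu.memWeakL_mul_log hn hα hθ hΩ ha hab hm hmn hf hr hrθ

theorem mainTheorem4 (n : ℕ) (hn : 2 < n) (α : ℝ) (hα : 0 < α)
    (μ : ℝ) (hμ : DegenerateElliptic.IsGrowthExponent μ)
    (m : ℝ) (hm : 2 * (n : ℝ) / ((n : ℝ) + 2) < m) :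
    -- (i) the bound `L` depends only on `n, α, β, μ, m, N = ‖f‖` and `V = |Ω|`
    ((n : ℝ) / 2 < m → ∀ β : ℝ, 0 < β → ∀ N V : ℝ, ∃ L : ℝ, 0 < L ∧
      ∀ θ : ℝ, 0 ≤ θ → θ < 1 →
      ∀ Ω : Set (EuclideanSpace ℝ (Fin n)), IsOpen Ω → Bornology.IsBounded Ω →
        volume.real Ω = V →
      ∀ a : EuclideanSpace ℝ (Fin n) → ℝ → ℝ, DegenerateElliptic.IsCaratheodory Ω a →
        DegenerateElliptic.DegenerateBounds Ω α β θ a →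
      ∀ f : EuclideanSpace ℝ (Fin n) → ℝ, DegenerateElliptic.MemWeakL m Ω f →
        DegenerateElliptic.weakNorm m Ω f = N →
      ∀ u : EuclideanSpace ℝ (Fin n) → ℝ, DegenerateElliptic.IsWeakSolution Ω a f u →
        ∀ᵐ x ∂(volume.restrict Ω), |u x| ≤ 2 * L) ∧
    -- (ii) the constant `l` depends only on `n, α, μ, m, θ` and `N = ‖f‖`
    (m = (n : ℝ) / 2 → ∀ θ : ℝ, 0 ≤ θ → μ * θ < 1 → ∀ N : ℝ, ∃ l : ℝ, 0 < l ∧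
      ∀ ρ : ℝ, 0 < ρ → ρ < 1 - θ →
      ∀ β : ℝ, 0 < β →
      ∀ Ω : Set (EuclideanSpace ℝ (Fin n)), IsOpen Ω → Bornology.IsBounded Ω →
      ∀ a : EuclideanSpace ℝ (Fin n) → ℝ → ℝ, DegenerateElliptic.IsCaratheodory Ω a →
        DegenerateElliptic.DegenerateBounds Ω α β θ a →
      ∀ f : EuclideanSpace ℝ (Fin n) → ℝ, DegenerateElliptic.MemWeakL m Ω f →
        DegenerateElliptic.weakNorm m Ω f = N →
      ∀ u : EuclideanSpace ℝ (Fin n) → ℝ, DegenerateElliptic.IsWeakSolution Ω a f u →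
        IntegrableOn (fun x => Real.exp (l * |u x| ^ ρ)) Ω volume) ∧
    -- (iii)
    (m < (n : ℝ) / 2 → ∀ θ : ℝ, 0 ≤ θ → θ < 1 →
      ∀ r : ℝ, 0 < r → r < (n : ℝ) * m / ((n : ℝ) - 2 * m) * (1 - θ) →
      ∀ β : ℝ, 0 < β →
      ∀ Ω : Set (EuclideanSpace ℝ (Fin n)), IsOpen Ω → Bornology.IsBounded Ω →
      ∀ a : EuclideanSpace ℝ (Fin n) → ℝ → ℝ, DegenerateElliptic.IsCaratheodory Ω a →
        DegenerateElliptic.DegenerateBounds Ω α β θ a →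
      ∀ f : EuclideanSpace ℝ (Fin n) → ℝ, DegenerateElliptic.MemWeakL m Ω f →
      ∀ u : EuclideanSpace ℝ (Fin n) → ℝ, DegenerateElliptic.IsWeakSolution Ω a f u →
        DegenerateElliptic.MemWeakL r Ω
          (fun x => |u x| * Real.log (Real.exp 1 + |u x|))) := by
  have hm1 : 1 < m := by
    have hn' : (2 : ℝ) < n := by exact_mod_cast hn
    exact ((one_lt_div (by positivity)).2 (by linarith)).trans hm
  obtain ⟨hbounded, hexp, hweak⟩ := mainTheorem4_general n hn α hα m
  refine ⟨fun hmn β _ N V => ?_, fun hmn θ hθ _ N => ⟨1, one_pos, ?_⟩, ?_⟩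
  · obtain ⟨L, hL, hbound⟩ := hbounded hmn N V
    refine ⟨L, hL, fun θ hθ hθ1 Ω _ hΩ hV a ha hab f hf hN u hu => ?_⟩
    obtain ⟨Du, hu⟩ := hu.exists_isBoundedTestSolution
    filter_upwards [hbound θ hθ hθ1.le Ω hΩ.measure_lt_top.ne hV.le β a ha hab f hf hN.le u Du hu]
      with x hx
    linarith
  · intro ρ hρ hρθ β _ Ω _ hΩ a ha hab f hf _ u hu
    obtain ⟨Du, hu⟩ := hu.exists_isBoundedTestSolution
    exact hexp hmn θ hθ ρ hρ hρθ 1 Ω hΩ.measure_lt_top.ne β a ha hab f hf u Du hu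
  · intro hmn θ hθ _ r hr hrθ β _ Ω _ hΩ a ha hab f hf u hu
    obtain ⟨Du, hu⟩ := hu.exists_isBoundedTestSolution
    exact hweak hm1 hmn θ hθ r hr hrθ Ω hΩ.measure_lt_top.ne β a ha hab f hf u Du hu
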